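/- Notation. For a function $f$ on a nonempty finite set $A$ let $\mathbf E(f\mid A)=\mathbf E(f(x)\mid x\in A)$ be its arithmetic mean; $N$ denotes a prime and $\mathbf Z_N=\mathbf Z/N\mathbf Z$. For a $\sigma$-algebra $\mathcal B$ on $\mathbf Z_N$ and $f:\mathbf Z_N\to\mathbf R$, $\mathbf E(f\mid\mathcal B)(x)=\mathbf E(f\mid A)$, where $A$ is the atom of $\mathcal B$ containing $x$. For $d\ge 1$, $$\|f\|_{U^d}=\Bigl(\mathbf E\Bigl(\prod_{\omega\in\{0,1\}^d}f(x+\omega_1t_1+\dots+\omega_dt_d)\ \Big|\ x\in\mathbf Z_N,\ t\in\mathbf Z_N^d\Bigr)\Bigr)^{1/2^d}.$$ Let $m_0,t,L,q_0$ be non-negative integers. A pseudorandom weight with these parameters is a family $\nu=(\nu_N)_{N\text{ prime}}$ of functions $\nu_N:\mathbf Z_N\to[0,\infty)$ such that: (i) (linear forms condition) for every $\eta>0$ there is $N_1$ such that for every prime $N>N_1$, every $m\le m_0$, all integers $b_1,\dots,b_m$ and all integers $L_{i,j}$ ($1\le i\le m$, $1\le j\le t$) with $|L_{i,j}|\le L$,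 such that the vectors $(L_{i,1},\dots,L_{i,t})\in\mathbf Z^t$ are nonzero and pairwise non-collinear, the forms $\psi_i(\mathbf x)=b_i+\sum_{j=1}^tL_{i,j}x_j$ satisfy $$\bigl|\mathbf E\bigl(\nu_N(\psi_1(\mathbf x))\cdots\nu_N(\psi_m(\mathbf x))\mid\mathbf x\in\mathbf Z_N^t\bigr)-1\bigr|\le\eta ;$$ (ii) (correlation condition) there are functions $\tau_N:\mathbf Z_N\to[0,\infty)$, $N$ prime, such that for every real $p\ge1$ the quantity $\mathbf E(\tau_N^p\mid\mathbf Z_N)$ is bounded independently of $N$, and for all primes $N$, all $1\le q\le q_0$ and all $h_1,\dots,h_q\in\mathbf Z_N$, distinct or not, $$\mathbf E\bigl(\nu_N(x+h_1)\cdots\nu_N(x+h_q)\mid x\in\mathbf Z_N\bigr)\le\sum_{1\le i\le j\le q}\tau_N(h_i-h_j).$$ **Proposition.** Let $k\ge2$ be an integer. There are integers $m_0,t,L,q_0$, depending only on $k$, such that the following holds for every pseudorandom weight $\nu$ with these parameters. For every $\varepsilon>0$ there are an integer $N_0$ and a sequence $\delta(N)\to0$ ($N\to\infty$), depending on $k,\nu,\varepsilon$,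 such that for every prime $N>N_0$ and every $f:\mathbf Z_N\to\mathbf R$ with $0\le f(x)\le\nu_N(x)$ for all $x$, there are a $\sigma$-algebra $\mathcal B$ on $\mathbf Z_N$ and a set $\Omega\in\mathcal B$ with $$\bigl|\mathbf E(\nu_N\cdot\mathbf 1_\Omega\mid\mathbf Z_N)\bigr|\le\delta(N),\qquad \bigl\|(1-\mathbf 1_\Omega)\,\mathbf E(\nu_N-1\mid\mathcal B)\bigr\|_{L^\infty}\le\delta(N),\qquad \bigl\|(1-\mathbf 1_\Omega)\,(f-\mathbf E(f\mid\mathcal B))\bigr\|_{U^k}\le\varepsilon .$$ -/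

import Mathlib

open scoped BigOperators

noncomputable section

namespace PseudorandomDecomposition

/-- The linear forms condition with parameters `m₀`, `t`, `L` for a family of functions `ν N` on
`ℤ/Nℤ`: the average of `ν(ψ₁(x)) ⋯ ν(ψₘ(x))` over `x ∈ (ℤ/Nℤ)ᵗ` is `1 + o(1)` as the prime `N`
tends to infinity, uniformly over `m ≤ m₀` and over all affine forms
`ψᵢ(x) = bᵢ + ∑ⱼ Aᵢⱼ xⱼ` whose coefficients are integers, `|Aᵢⱼ| ≤ L`, and whose
coefficient vectors `Aᵢ ∈ ℤᵗ` are nonzero and pairwise non-collinear. -/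
def LinearFormsCondition (m₀ t L : ℕ) (ν : (N : ℕ) → ZMod N → ℝ) : Prop :=
  ∀ η : ℝ, 0 < η → ∃ N₀ : ℕ, ∀ (N : ℕ) [Fact N.Prime], N₀ < N →
    ∀ m : ℕ, m ≤ m₀ → ∀ (b : Fin m → ℤ) (A : Fin m → Fin t → ℤ),
      (∀ i j, |A i j| ≤ (L : ℤ)) →
      (∀ i, A i ≠ 0) →
      (∀ i i', i ≠ i' → LinearIndependent ℤ ![A i, A i']) →
      |(𝔼 x : Fin t → ZMod N, ∏ i, ν N ((b i : ZMod N) + ∑ j, (A i j : ZMod N) * x j)) - 1| ≤ η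

/-- The correlation condition with parameter `q₀`: there are nonnegative functions `τ N` on
`ℤ/Nℤ`, all of whose moments are bounded independently of the prime `N`, which control the
correlations of at most `q₀` translates of `ν N`. -/
def CorrelationCondition (q₀ : ℕ) (ν : (N : ℕ) → ZMod N → ℝ) : Prop :=
  ∃ τ : (N : ℕ) → ZMod N → ℝ,
    (∀ (N : ℕ) [Fact N.Prime] (x : ZMod N), 0 ≤ τ N x) ∧
    (∀ p : ℝ, 1 ≤ p → ∃ C : ℝ, ∀ (N : ℕ) [Fact N.Prime], 𝔼 x : ZMod N, τ N x ^ p ≤ C) ∧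
    ∀ (N : ℕ) [Fact N.Prime] (q : ℕ), 1 ≤ q → q ≤ q₀ → ∀ h : Fin q → ZMod N,
      𝔼 x : ZMod N, ∏ i, ν N (x + h i) ≤
        ∑ ij : Fin q × Fin q with ij.1 ≤ ij.2, τ N (h ij.1 - h ij.2)

/-- A pseudorandom weight, with parameters `m₀`, `t`, `L`, `q₀`: a family of nonnegative functions
on the groups `ℤ/Nℤ`, `N` prime, with the linear forms condition and the correlation condition.
The values of `ν N` for `N` not prime play no role. -/
structure IsPseudorandom (m₀ t L q₀ : ℕ) (ν : (N : ℕ) → ZMod N → ℝ) : Prop where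
  nonneg : ∀ (N : ℕ) [Fact N.Prime] (x : ZMod N), 0 ≤ ν N x
  linearForms : LinearFormsCondition m₀ t L ν
  correlation : CorrelationCondition q₀ ν

/-- The Gowers norm `‖f‖_{U^d}` of a real function on `ℤ/Nℤ`, `d ≥ 1`:
`‖f‖_{U^d}^{2^d}` is the average of `∏_ω f(x + ω·t)` over `x ∈ ℤ/Nℤ` and `t ∈ (ℤ/Nℤ)^d`, where
`ω` runs through `{0,1}^d`. (For `d ≥ 1` this average is nonnegative.) -/
def gowersNorm {N : ℕ} [NeZero N] (d : ℕ) (f : ZMod N → ℝ) : ℝ :=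
  (𝔼 x : ZMod N, 𝔼 t : Fin d → ZMod N,
    ∏ ω : Fin d → Bool, f (x + ∑ i, if ω i then t i else 0)) ^ ((1 : ℝ) / 2 ^ d)

open Classical in
/-- The conditional expectation `E(f | B)` on `ℤ/Nℤ` with its uniform probability: at `x` it is the
average of `f` over the atom of `B` containing `x`. -/
def condExpect {N : ℕ} [NeZero N] (B : MeasurableSpace (ZMod N)) (f : ZMod N → ℝ)
    (x : ZMod N) : ℝ :=
  𝔼 y : ZMod N with y ∈ @measurableAtom (ZMod N) B x, f y

end PseudorandomDecomposition

end

open scoped BigOperators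

noncomputable section

namespace PseudorandomDecomposition

/-! The test functions are the dual functions `x ↦ 𝔼_h ∏_{ω ≠ 0} g_ω(x + ω·h)` of systems bounded by
`1`. A product of two of them is an average of such functions. Hence polynomials in them, and
approximately the indicators of their level sets, pair with any `f` at a cost controlled by the
largest pairing of `f` with a dual function. If `ν - 1` hardly correlates with dual functions, then
`ν` has mean close to `1` on most cells of every partition generated by boundedly many such
level-set partitions.

`exists_partition` is an energy increment argument. If `f - E(f | B)`, off the exceptional cells,
correlates with a dual function, refining `B` by the level sets of that function raises the energy
by a fixed amount (`energy_increment`). Only the mean of `f` is bounded, so the energy is built on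
`huber`: quadratic where the averages are at most `2`, as they are off the exceptional cells, and
linear above. The energy is bounded, so the refinement stops.

There remains the passage to the `U^k` norm of `F = (1 - 1_Ω)(f - E(f | B))`, which is dominated
only by `2(ν + 1)`, from its small correlation with dual functions of bounded systems.
`abs_cubeAvg_le_of_corr` makes the functions bounded one vertex at a time. With a vertex `ω` as base
point the cube average is `𝔼 g_ω D`, with `D` a dual function; Cauchy–Schwarz with weight `ν + 1`
leads to `𝔼 (ν + 1) D²`. Since `D²` is a dual function on a cube of twice the dimension
(`dualFn_glue`), `ν + 1` may be replaced by `2`, and `𝔼 D²` is the cube average with `g_ω` replaced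
by the bounded `D`.

The facts needed about `ν` are collected in `WeightBounds`; they follow from the linear forms
condition on cubes of dimension `2k`, with free or fixed base point. -/

/-! ### Test classes and the dual norm -/

/-- `g` lies in `M` times the absolutely convex hull of `𝒟`, in the dual formulation: pairing with
`g` is bounded by `M` times the largest pairing with an element of `𝒟`. -/
def DualBound {X : Type} [Fintype X] (𝒟 : Set (X → ℝ)) (M : ℝ) (g : X → ℝ) : Prop :=
  ∀ (f : X → ℝ) (c : ℝ), (∀ φ ∈ 𝒟, |𝔼 x, f x * φ x| ≤ c) → |𝔼 x, f x * g x| ≤ M * c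

/-- A class of functions bounded by `1`, containing `1`, with products in its convex hull. -/
structure IsTestClass {X : Type} [Fintype X] (𝒟 : Set (X → ℝ)) : Prop where
  one_mem : (fun _ => 1) ∈ 𝒟
  abs_le_one : ∀ φ ∈ 𝒟, ∀ x, |φ x| ≤ 1
  mul : ∀ φ ∈ 𝒟, ∀ ψ ∈ 𝒟, DualBound 𝒟 1 (fun x => φ x * ψ x)

section DualBound

variable {X : Type} [Fintype X] {𝒟 : Set (X → ℝ)}

lemma IsTestClass.nonneg_of_bound (h𝒟 : IsTestClass 𝒟) {f : X → ℝ} {c : ℝ}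
    (h : ∀ φ ∈ 𝒟, |𝔼 x, f x * φ x| ≤ c) : 0 ≤ c :=
  (abs_nonneg _).trans (h _ h𝒟.one_mem)

lemma IsTestClass.dualBound_of_mem {φ : X → ℝ} (hφ : φ ∈ 𝒟) : DualBound 𝒟 1 φ :=
  fun f c h => by simpa using h φ hφ

lemma DualBound.mono (h𝒟 : IsTestClass 𝒟) {M M' : ℝ} {g : X → ℝ} (h : DualBound 𝒟 M g)
    (hM : M ≤ M') : DualBound 𝒟 M' g := fun f c hf =>
  (h f c hf).trans (mul_le_mul_of_nonneg_right hM (h𝒟.nonneg_of_bound hf))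

/-- Duality is used twice: pairing `f * g'` with `φ` is pairing `f * φ` with `g'`, and `f * φ` pairs
with test functions as `f` does with products of two of them. -/
lemma DualBound.mul (h𝒟 : IsTestClass 𝒟) {M M' : ℝ} {g g' : X → ℝ} (h : DualBound 𝒟 M g)
    (h' : DualBound 𝒟 M' g') : DualBound 𝒟 (M * M') (fun x => g x * g' x) := by
  intro f c hf
  have key : ∀ φ ∈ 𝒟, |𝔼 x, (f x * g' x) * φ x| ≤ M' * c := by
    intro φ hφ
    have := h' (fun x => f x * φ x) c (fun ψ hψ => by
      simpa [mul_assoc] using h𝒟.mul φ hφ ψ hψ f c hf)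
    simpa [mul_assoc, mul_comm, mul_left_comm] using this
  have := h (fun x => f x * g' x) (M' * c) key
  simpa [mul_assoc, mul_comm, mul_left_comm] using this

lemma DualBound.sum {α : Type*} (s : Finset α) {M : α → ℝ} {g : α → X → ℝ}
    (h : ∀ a ∈ s, DualBound 𝒟 (M a) (g a)) :
    DualBound 𝒟 (∑ a ∈ s, M a) (fun x => ∑ a ∈ s, g a x) := by
  intro f c hf
  simp only [Finset.mul_sum, Finset.expect_sum_comm, Finset.sum_mul]
  exact (Finset.abs_sum_le_sum_abs _ _).trans (Finset.sum_le_sum fun a ha => h a ha f c hf)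

lemma DualBound.const_mul {M : ℝ} {g : X → ℝ} (h : DualBound 𝒟 M g) (r : ℝ) :
    DualBound 𝒟 (|r| * M) (fun x => r * g x) := by
  intro f c hf
  have : 𝔼 x, f x * (r * g x) = r * 𝔼 x, f x * g x := by
    rw [Finset.mul_expect]; exact Finset.expect_congr rfl fun x _ => by ring
  rw [this, abs_mul, mul_assoc]
  exact mul_le_mul_of_nonneg_left (h f c hf) (abs_nonneg _)

lemma DualBound.pow (h𝒟 : IsTestClass 𝒟) {φ : X → ℝ} (hφ : φ ∈ 𝒟) (n : ℕ) :
    DualBound 𝒟 1 (fun x => φ x ^ n) := by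
  induction n with
  | zero => simpa using IsTestClass.dualBound_of_mem h𝒟.one_mem
  | succ n ih =>
    simpa [pow_succ] using ih.mul h𝒟 (IsTestClass.dualBound_of_mem hφ)

/-- The sum of the absolute values of the coefficients of a polynomial. -/
def coeffSum (p : Polynomial ℝ) : ℝ := ∑ i ∈ p.support, |p.coeff i|

lemma coeffSum_nonneg (p : Polynomial ℝ) : 0 ≤ coeffSum p :=
  Finset.sum_nonneg fun _ _ => abs_nonneg _

lemma DualBound.polynomial (h𝒟 : IsTestClass 𝒟) {φ : X → ℝ} (hφ : φ ∈ 𝒟) (p : Polynomial ℝ) :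
    DualBound 𝒟 (coeffSum p) (fun x => p.eval (φ x)) := by
  have := DualBound.sum p.support (M := fun i => |p.coeff i| * 1)
    (g := fun i x => p.coeff i * φ x ^ i)
    (fun i _ => (DualBound.pow h𝒟 hφ i).const_mul (p.coeff i))
  simpa [coeffSum, Polynomial.eval_eq_sum, Polynomial.sum] using this

end DualBound

/-! ### Level sets of bounded functions and polynomial approximation -/

/-- The trapezoid function, equal to `1` on `[0, R - 1]` and to `0` off `[-1, R]`. -/
def trapezoid (R v : ℝ) : ℝ := max 0 (min 1 (min (v + 1) (R - v)))

lemma trapezoid_nonneg (R v : ℝ) : 0 ≤ trapezoid R v := le_max_left _ _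

lemma trapezoid_le_one (R v : ℝ) : trapezoid R v ≤ 1 := max_le zero_le_one (min_le_left _ _)

lemma trapezoid_eq_one {R v : ℝ} (h0 : 0 ≤ v) (h1 : v ≤ R - 1) : trapezoid R v = 1 := by
  unfold trapezoid
  rw [min_eq_left (le_min (by linarith) (by linarith)), max_eq_right zero_le_one]

lemma trapezoid_eq_zero {R v : ℝ} (h : v ≤ -1 ∨ R ≤ v) : trapezoid R v = 0 := by
  unfold trapezoid
  apply max_eq_left
  rcases h with h | h
  · exact (min_le_right _ _).trans ((min_le_left _ _).trans (by linarith))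
  · exact (min_le_right _ _).trans ((min_le_right _ _).trans (by linarith))

lemma trapezoid_continuous (R : ℝ) : Continuous (trapezoid R) := by
  unfold trapezoid; fun_prop

/-- Away from the last unit interval of each block of length `R`, the trapezoid over a block is its
indicator function. -/
lemma trapezoid_eq_ite {R r m j : ℕ} (hr : r < R) {a : ℝ} (h0 : (j : ℝ) ≤ a) (h1 : a < j + 1)
    (hj : j % R ≠ r) :
    trapezoid R (a + ((R : ℝ) - 1 - r) - m * R) =
      if (j + (R - 1 - r)) / R = m then 1 else 0 := by
  set q := (j + (R - 1 - r)) / R with hq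
  set ρ := (j + (R - 1 - r)) % R with hρ
  have hdiv : R * q + ρ = j + (R - 1 - r) := Nat.div_add_mod _ _
  have hρR : ρ < R := Nat.mod_lt _ (by omega)
  have hρ' : ρ + 2 ≤ R := by
    by_contra hcon
    have h2 : ρ = R - 1 := by omega
    apply hj
    have : j = r + R * q := by omega
    rw [this, Nat.add_mul_mod_self_left, Nat.mod_eq_of_lt hr]
  have hdivR : (R : ℝ) * q + ρ = j + ((R : ℝ) - 1 - r) := by
    have : ((R - 1 - r : ℕ) : ℝ) = (R : ℝ) - 1 - r := by
      rw [Nat.cast_sub (by omega), Nat.cast_sub (by omega)]; simp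
    rw [← this]; exact_mod_cast hdiv
  have hρ'R : (ρ : ℝ) + 2 ≤ R := by exact_mod_cast hρ'
  have hρ0 : (0 : ℝ) ≤ ρ := Nat.cast_nonneg _
  have hR0 : (0 : ℝ) ≤ R := Nat.cast_nonneg _
  rcases lt_trichotomy q m with h | h | h
  · rw [if_neg h.ne]
    apply trapezoid_eq_zero
    left
    have : (q : ℝ) + 1 ≤ m := by exact_mod_cast h
    nlinarith
  · rw [if_pos h]
    subst h
    apply trapezoid_eq_one <;> nlinarith
  · rw [if_neg h.ne']
    apply trapezoid_eq_zero
    right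
    have : (m : ℝ) + 1 ≤ q := by exact_mod_cast h
    nlinarith

/-- Pigeonhole: the residue classes share the total weight, so one has at most the average. -/
lemma exists_residue_small {X : Type} [Fintype X] (w : X → ℝ) (C : ℝ) (hw : 𝔼 x, w x ≤ C)
    (R : ℕ) (hR : 0 < R) (j : X → ℕ) :
    ∃ r < R, 𝔼 x, w x * (if j x % R = r then 1 else 0) ≤ C / R := by
  have hsum : ∑ r ∈ Finset.range R, 𝔼 x, w x * (if j x % R = r then 1 else 0) = 𝔼 x, w x := by
    rw [← Finset.expect_sum_comm]
    refine Finset.expect_congr rfl fun x _ => ?_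
    rw [← Finset.mul_sum, Finset.sum_ite_eq, if_pos (Finset.mem_range.2 (Nat.mod_lt _ hR)),
      mul_one]
  by_contra! hcon
  have : ∑ _r ∈ Finset.range R, C / R <
      ∑ r ∈ Finset.range R, 𝔼 x, w x * (if j x % R = r then 1 else 0) :=
    Finset.sum_lt_sum_of_nonempty ⟨0, Finset.mem_range.2 hR⟩
      fun r hr => hcon r (Finset.mem_range.1 hr)
  rw [hsum, Finset.sum_const, Finset.card_range, nsmul_eq_mul,
    mul_div_cancel₀ _ (by positivity)] at this
  linarith

/-- A bounded function has a partition into level sets of width `1 / s` whose indicator functions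
are close, in a weighted `L¹` sense, to polynomials in the function; the polynomials are of
complexity bounded independently of the function. -/
lemma exists_level_sets (s : ℕ) (hs : 0 < s) (κ : ℝ) (hκ : 0 < κ) :
    ∃ M : ℝ, 0 ≤ M ∧ ∀ (X : Type) [Fintype X] (w φ : X → ℝ), (∀ x, 0 ≤ w x) →
      𝔼 x, w x ≤ 4 → (∀ x, |φ x| ≤ 1) →
      ∃ (c : X → Fin (2 * s + 2)) (p : Fin (2 * s + 2) → Polynomial ℝ),
        (∀ x y, c x = c y → |φ x - φ y| ≤ 1 / s) ∧ (∀ m, coeffSum (p m) ≤ M) ∧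
        (∀ m, 𝔼 x, w x * |(if c x = m then 1 else 0) - (p m).eval (φ x)| ≤ κ) ∧
        ∀ m x, |(p m).eval (φ x)| ≤ 2 := by
  obtain ⟨R, hR⟩ := exists_nat_gt (8 / κ)
  have hR0 : (0 : ℝ) < R := (by positivity : (0:ℝ) < 8 / κ).trans hR
  have hRn : 0 < R := by exact_mod_cast hR0
  set Q : ℝ := R * s with hQ
  have hs' : (0 : ℝ) < s := by exact_mod_cast hs
  have hQ0 : 0 < Q := by positivity
  -- With total weight at most `4`, an error `κ / 8` costs `κ / 2`, the transition strips costing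
  -- the other half. The bound `1` keeps the polynomials below `2`.
  set ξ : ℝ := min 1 (κ / 8) with hξ
  have hξ0 : 0 < ξ := by positivity
  -- The polynomials are fixed for every shift `r` and block `m` before `φ` and `w` are given; this
  -- makes `M` uniform.
  have happ : ∀ (r : Fin R) (m : Fin (2 * s + 2)), ∃ p : Polynomial ℝ, ∀ t ∈ Set.Icc (-1 : ℝ) 1,
      |p.eval t - trapezoid R ((t + 1) * Q + ((R : ℝ) - 1 - (r : ℕ)) - (m : ℕ) * R)| < ξ := by
    intro r m
    refine exists_polynomial_near_of_continuousOn (-1) 1 _ ?_ ξ hξ0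
    exact ((trapezoid_continuous R).comp (by fun_prop)).continuousOn
  choose p hp using happ
  refine ⟨∑ r, ∑ m, coeffSum (p r m),
    Finset.sum_nonneg fun _ _ => Finset.sum_nonneg fun _ _ => coeffSum_nonneg _, ?_⟩
  intro X _ w φ hw hw4 hφ
  have hφI : ∀ x, φ x ∈ Set.Icc (-1 : ℝ) 1 := fun x => abs_le.1 (hφ x)
  set j : X → ℕ := fun x => ⌊(φ x + 1) * Q⌋₊ with hj
  have ha0 : ∀ x, 0 ≤ (φ x + 1) * Q := fun x =>
    mul_nonneg (by linarith [(hφI x).1]) hQ0.le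
  have hj0 : ∀ x, (j x : ℝ) ≤ (φ x + 1) * Q := fun x => Nat.floor_le (ha0 x)
  have hj1 : ∀ x, (φ x + 1) * Q < j x + 1 := fun x => Nat.lt_floor_add_one _
  have hjle : ∀ x, j x ≤ 2 * (R * s) := by
    intro x
    have : (j x : ℝ) ≤ ((2 * (R * s) : ℕ) : ℝ) := by
      push_cast
      refine (hj0 x).trans ?_
      rw [← hQ]
      exact mul_le_mul_of_nonneg_right (by linarith [(hφI x).2]) hQ0.le
    exact_mod_cast this
  -- The shift is chosen so that the strips where the trapezoids are not indicators carry weight at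
  -- most `4 / R`.
  obtain ⟨r, hr, hrsmall⟩ := exists_residue_small w 4 hw4 R hRn j
  have hclt : ∀ x, (j x + (R - 1 - r)) / R < 2 * s + 2 := by
    intro x
    rw [Nat.div_lt_iff_lt_mul hRn]
    have := hjle x
    have h2 : (2 * s + 2) * R = 2 * (R * s) + 2 * R := by ring
    omega
  -- Translation by `R - 1 - r` moves the strip of residue `r` to the end of each block of `R`
  -- strips.
  refine ⟨fun x => ⟨(j x + (R - 1 - r)) / R, hclt x⟩, p ⟨r, hr⟩, ?_, ?_, ?_, ?_⟩
  · intro x y hxy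
    have hxy' : (j x + (R - 1 - r)) / R = (j y + (R - 1 - r)) / R := by simpa using hxy
    have hlt : ∀ x y, (j x + (R - 1 - r)) / R = (j y + (R - 1 - r)) / R → j x + 1 ≤ j y + R := by
      intro x y h
      have h1 := Nat.div_add_mod (j x + (R - 1 - r)) R
      have h2 := Nat.div_add_mod (j y + (R - 1 - r)) R
      have h3 := Nat.mod_lt (j x + (R - 1 - r)) hRn
      rw [h] at h1
      omega
    have hdiff : ∀ x y, (j x + (R - 1 - r)) / R = (j y + (R - 1 - r)) / R →
        φ x - φ y ≤ 1 / s := by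
      intro x y h
      have h1 : (j x : ℝ) + 1 ≤ j y + R := by exact_mod_cast hlt x y h
      have h2 : (φ x - φ y) * Q ≤ R := by
        have := hj1 x; have := hj0 y; nlinarith
      rw [le_div_iff₀ hs']
      have h3 : (φ x - φ y) * s * R ≤ 1 * R := by rw [hQ] at h2; linarith
      exact le_of_mul_le_mul_right h3 hR0
    rw [abs_le]
    constructor
    · linarith [hdiff y x hxy'.symm]
    · exact hdiff x y hxy'
  · intro m
    refine (Finset.single_le_sum (f := fun m => coeffSum (p ⟨r, hr⟩ m))
      (fun _ _ => coeffSum_nonneg _) (Finset.mem_univ m)).trans ?_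
    exact Finset.single_le_sum (f := fun r => ∑ m, coeffSum (p r m))
      (fun _ _ => Finset.sum_nonneg fun _ _ => coeffSum_nonneg _) (Finset.mem_univ _)
  · intro m
    have hpt : ∀ x, w x * |(if (⟨(j x + (R - 1 - r)) / R, hclt x⟩ : Fin (2 * s + 2)) = m
        then 1 else 0) - (p ⟨r, hr⟩ m).eval (φ x)| ≤
        w x * (if j x % R = r then 1 else 0) + w x * (κ / 8) := by
      intro x
      rw [← mul_add]
      refine mul_le_mul_of_nonneg_left ?_ (hw x)
      have h1 := (hp ⟨r, hr⟩ m (φ x) (hφI x)).le.trans (min_le_right 1 (κ / 8))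
      set v := (φ x + 1) * Q + ((R : ℝ) - 1 - r) - (m : ℕ) * R with hv
      have h2 : |(if (⟨(j x + (R - 1 - r)) / R, hclt x⟩ : Fin (2 * s + 2)) = m
          then (1 : ℝ) else 0) - trapezoid R v| ≤ if j x % R = r then 1 else 0 := by
        by_cases hbad : j x % R = r
        · rw [if_pos hbad]
          have := trapezoid_nonneg R v
          have := trapezoid_le_one R v
          split_ifs <;> rw [abs_le] <;> constructor <;> linarith
        · rw [if_neg hbad, hv, trapezoid_eq_ite hr (hj0 x) (hj1 x) hbad]
          simp [Fin.ext_iff]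
      calc _ ≤ _ := abs_sub_le _ (trapezoid R v) _
        _ ≤ _ := add_le_add h2 (by rw [abs_sub_comm]; exact h1)
    refine (Finset.expect_le_expect fun x _ => hpt x).trans ?_
    rw [Finset.expect_add_distrib, ← Finset.expect_mul]
    have h4 : (4 : ℝ) / R ≤ κ / 2 := by
      rw [div_lt_iff₀ hκ] at hR
      rw [div_le_div_iff₀ hR0 two_pos]; linarith
    nlinarith
  · intro m x
    have h1 := (hp ⟨r, hr⟩ m (φ x) (hφI x)).le.trans (min_le_left 1 (κ / 8))
    set v := (φ x + 1) * Q + ((R : ℝ) - 1 - r) - (m : ℕ) * R with hv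
    have := trapezoid_nonneg R v
    have := trapezoid_le_one R v
    rw [abs_le] at h1 ⊢
    constructor <;> linarith [h1.1, h1.2]

/-! ### Partitions, conditional expectations and exceptional cells -/

section Partition

variable {X ι ι' : Type} [Fintype X]

/-- The indicator functions of the cells of the partition `c` are within `κ`, in total and in
`L¹(w)`, of functions of dual norm at most `M`. -/
def Approximable [Fintype ι] [DecidableEq ι] (𝒟 : Set (X → ℝ)) (w : X → ℝ) (c : X → ι)
    (κ M : ℝ) : Prop :=
  ∃ Ψ : ι → X → ℝ, (∀ a, DualBound 𝒟 M (Ψ a)) ∧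
    ∑ a, 𝔼 x, w x * |(if c x = a then 1 else 0) - Ψ a x| ≤ κ

lemma Approximable.mono [Fintype ι] [DecidableEq ι] {𝒟 : Set (X → ℝ)} {w : X → ℝ} {c : X → ι}
    {κ κ' M : ℝ} (h : Approximable 𝒟 w c κ M) (hκ : κ ≤ κ') : Approximable 𝒟 w c κ' M := by
  obtain ⟨Ψ, h1, h2⟩ := h
  exact ⟨Ψ, h1, h2.trans hκ⟩

/-- A function constant on cells is a combination of cell indicators with coefficients in `[-1, 1]`.
Replacing the indicators by the `Ψ a` costs `κ` in all, and each `Ψ a` then contributes at most `M *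
θ`. -/
lemma Approximable.abs_expect_le [Nonempty X] [Fintype ι] [DecidableEq ι] {𝒟 : Set (X → ℝ)}
    {w u : X → ℝ} {c : X → ι} {κ M θ : ℝ} (h : Approximable 𝒟 w c κ M)
    (huw : ∀ x, |u x| ≤ w x) (hu : ∀ φ ∈ 𝒟, |𝔼 x, u x * φ x| ≤ θ) (h' : X → ℝ)
    (hh : ∀ x y, c x = c y → h' x = h' y) (hh1 : ∀ x, |h' x| ≤ 1) :
    |𝔼 x, h' x * u x| ≤ κ + Fintype.card ι * (M * θ) := by
  classical
  obtain ⟨Ψ, h1, h2⟩ := h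
  set t : ι → ℝ := fun a => h' (Function.invFun c a) with ht
  have hht : ∀ x, h' x = t (c x) := fun x => hh _ _ (Function.invFun_eq ⟨x, rfl⟩).symm
  have ht1 : ∀ a, |t a| ≤ 1 := fun a => hh1 _
  have hexp : 𝔼 x, h' x * u x = ∑ a, t a * 𝔼 x, u x * (if c x = a then 1 else 0) := by
    simp only [Finset.mul_expect]
    rw [← Finset.expect_sum_comm]
    refine Finset.expect_congr rfl fun x _ => ?_
    rw [hht x]
    simp
  rw [hexp]
  have hterm : ∀ a, |t a * 𝔼 x, u x * (if c x = a then 1 else 0)| ≤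
      𝔼 x, w x * |(if c x = a then 1 else 0) - Ψ a x| + M * θ := by
    intro a
    rw [abs_mul]
    have h3 : 𝔼 x, u x * (if c x = a then (1 : ℝ) else 0) =
        𝔼 x, u x * ((if c x = a then 1 else 0) - Ψ a x) + 𝔼 x, u x * Ψ a x := by
      rw [← Finset.expect_add_distrib]
      exact Finset.expect_congr rfl fun x _ => by ring
    refine (mul_le_of_le_one_left (abs_nonneg _) (ht1 a)).trans ?_
    rw [h3]
    refine (abs_add_le _ _).trans (add_le_add ?_ (h1 a u θ hu))
    refine (Finset.abs_expect_le _ _).trans (Finset.expect_le_expect fun x _ => ?_)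
    rw [abs_mul]
    exact mul_le_mul_of_nonneg_right (huw x) (abs_nonneg _)
  refine (Finset.abs_sum_le_sum_abs _ _).trans ((Finset.sum_le_sum fun a _ => hterm a).trans ?_)
  rw [Finset.sum_add_distrib, Finset.sum_const, Finset.card_univ, nsmul_eq_mul]
  linarith

/-- Products `Ψ a * Ψ' m` serve, the error being `(1_c - Ψ)Ψ' + 1_c(1_{c'} - Ψ')`. Summed over `a`,
the first part costs `2 * κ` as `|Ψ'| ≤ 2`; the second costs a single `κ'`, because the cells of `c`
are disjoint. -/
lemma Approximable.prod [Fintype ι] [DecidableEq ι] [Fintype ι'] [DecidableEq ι']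
    {𝒟 : Set (X → ℝ)} (h𝒟 : IsTestClass 𝒟) {w : X → ℝ} (hw : ∀ x, 0 ≤ w x) {c : X → ι}
    {c' : X → ι'} {κ κ' M M' : ℝ} (h : Approximable 𝒟 w c κ M) (Ψ' : ι' → X → ℝ)
    (hD : ∀ a, DualBound 𝒟 M' (Ψ' a)) (h2 : ∀ a x, |Ψ' a x| ≤ 2)
    (hκ : ∀ a, 𝔼 x, w x * |(if c' x = a then 1 else 0) - Ψ' a x| ≤ κ') :
    Approximable 𝒟 w (fun x => (c x, c' x)) (Fintype.card ι' * (2 * κ + κ')) (M * M') := by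
  obtain ⟨Ψ, h3, h4⟩ := h
  refine ⟨fun a x => Ψ a.1 x * Ψ' a.2 x, fun a => (h3 a.1).mul h𝒟 (hD a.2), ?_⟩
  rw [Fintype.sum_prod_type_right, Fintype.card, ← smul_eq_mul, Nat.cast_smul_eq_nsmul,
    ← Finset.sum_const]
  refine Finset.sum_le_sum fun m _ => ?_
  have hpt : ∀ a x, w x * |(if (c x, c' x) = (a, m) then (1 : ℝ) else 0) - Ψ a x * Ψ' m x| ≤
      2 * (w x * |(if c x = a then 1 else 0) - Ψ a x|) +
      (if c x = a then w x * |(if c' x = m then 1 else 0) - Ψ' m x| else 0) := by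
    intro a x
    have hsplit : (if (c x, c' x) = (a, m) then (1 : ℝ) else 0) - Ψ a x * Ψ' m x =
        ((if c x = a then 1 else 0) - Ψ a x) * Ψ' m x +
        (if c x = a then 1 else 0) * ((if c' x = m then 1 else 0) - Ψ' m x) := by
      by_cases h5 : c x = a <;> by_cases h6 : c' x = m <;> simp [h5, h6] <;> ring
    rw [hsplit]
    have h7 := abs_add_le (((if c x = a then 1 else 0) - Ψ a x) * Ψ' m x)
      ((if c x = a then 1 else 0) * ((if c' x = m then 1 else 0) - Ψ' m x))
    rw [abs_mul, abs_mul] at h7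
    have h8 := mul_le_mul_of_nonneg_left (h2 m x)
      (abs_nonneg ((if c x = a then (1 : ℝ) else 0) - Ψ a x))
    refine (mul_le_mul_of_nonneg_left (h7.trans (add_le_add_left h8 _)) (hw x)).trans ?_
    by_cases h5 : c x = a <;> simp only [h5, if_true, if_false, abs_one, abs_zero] <;> linarith
  calc _ ≤ ∑ a, 𝔼 x, (2 * (w x * |(if c x = a then 1 else 0) - Ψ a x|) +
      (if c x = a then w x * |(if c' x = m then 1 else 0) - Ψ' m x| else 0)) :=
        Finset.sum_le_sum fun a _ => Finset.expect_le_expect fun x _ => hpt a x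
    _ = 2 * ∑ a, 𝔼 x, w x * |(if c x = a then 1 else 0) - Ψ a x| +
        𝔼 x, w x * |(if c' x = m then 1 else 0) - Ψ' m x| := by
      simp only [Finset.expect_add_distrib, Finset.sum_add_distrib, Finset.mul_sum,
        Finset.mul_expect]
      congr 1
      rw [← Finset.expect_sum_comm]
      simp
    _ ≤ 2 * κ + κ' := add_le_add (by linarith) (hκ m)

open Classical in
/-- The conditional expectation on the partition into the fibres of `c`. -/
def fiberAvg (c : X → ι) (f : X → ℝ) (x : X) : ℝ := 𝔼 y with c y = c x, f y

lemma fiberAvg_congr (c : X → ι) (f : X → ℝ) {x y : X} (h : c x = c y) :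
    fiberAvg c f x = fiberAvg c f y := by
  unfold fiberAvg; rw [h]

lemma fiber_nonempty [DecidableEq ι] (c : X → ι) (x : X) :
    (Finset.univ.filter fun y => c y = c x).Nonempty := ⟨x, by simp⟩

lemma fiberAvg_mono (c : X → ι) {f g : X → ℝ} (h : ∀ x, f x ≤ g x) (x : X) :
    fiberAvg c f x ≤ fiberAvg c g x := Finset.expect_le_expect fun y _ => h y

lemma fiberAvg_nonneg (c : X → ι) {f : X → ℝ} (h : ∀ x, 0 ≤ f x) (x : X) :
    0 ≤ fiberAvg c f x := Finset.expect_nonneg fun y _ => h y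

lemma fiberAvg_sub_one (c : X → ι) (f : X → ℝ) (x : X) :
    fiberAvg c (fun y => f y - 1) x = fiberAvg c f x - 1 := by
  classical
  unfold fiberAvg
  rw [Finset.expect_sub_distrib, Finset.expect_const]
  exact fiber_nonempty c x

/-- Conditional expectation is self-adjoint and fixes functions constant on cells: exchange the sums
over pairs in a common cell. -/
lemma expect_mul_fiberAvg (c : X → ι) (f h : X → ℝ) (hh : ∀ x y, c x = c y → h x = h y) :
    𝔼 x, h x * fiberAvg c f x = 𝔼 x, h x * f x := by
  classical
  simp only [fiberAvg, Finset.expect_eq_sum_div_card]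
  congr 1
  have h1 : ∀ x, h x * ((∑ y with c y = c x, f y) / (Finset.univ.filter fun y => c y = c x).card) =
      ∑ y, if c y = c x then h y * f y / (Finset.univ.filter fun z => c z = c y).card else 0 := by
    intro x
    rw [← Finset.sum_filter, Finset.sum_div, Finset.mul_sum]
    refine Finset.sum_congr rfl fun y hy => ?_
    have hy' : c y = c x := by simpa using hy
    rw [hy', hh y x hy', mul_div_assoc]
  simp only [h1]
  rw [Finset.sum_comm]
  refine Finset.sum_congr rfl fun y _ => ?_
  rw [← Finset.sum_filter, Finset.sum_const, nsmul_eq_mul]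
  have h2 : (Finset.univ.filter fun x => c y = c x) = Finset.univ.filter fun x => c x = c y := by
    ext; simp [eq_comm]
  have h3 : ((Finset.univ.filter fun x => c x = c y).card : ℝ) ≠ 0 := by
    exact_mod_cast (fiber_nonempty c y).card_pos.ne'
  rw [h2]
  field_simp

lemma expect_fiberAvg (c : X → ι) (f : X → ℝ) : 𝔼 x, fiberAvg c f x = 𝔼 x, f x := by
  simpa using expect_mul_fiberAvg c f (fun _ => 1) (fun _ _ _ => rfl)

/-- The `L¹` norm is the pairing of `u` with the sign of its conditional expectation, which is
constant on cells. -/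
lemma Approximable.expect_abs_fiberAvg_le [Nonempty X] [Fintype ι] [DecidableEq ι]
    {𝒟 : Set (X → ℝ)} {w u : X → ℝ} {c : X → ι} {κ M θ : ℝ} (h : Approximable 𝒟 w c κ M)
    (huw : ∀ x, |u x| ≤ w x) (hu : ∀ φ ∈ 𝒟, |𝔼 x, u x * φ x| ≤ θ) :
    𝔼 x, |fiberAvg c u x| ≤ κ + Fintype.card ι * (M * θ) := by
  set s : X → ℝ := fun x => if 0 ≤ fiberAvg c u x then 1 else -1 with hs
  have hsc : ∀ x y, c x = c y → s x = s y := by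
    intro x y hxy; simp only [hs, fiberAvg_congr c u hxy]
  have h1 : 𝔼 x, |fiberAvg c u x| = 𝔼 x, s x * fiberAvg c u x := by
    refine Finset.expect_congr rfl fun x _ => ?_
    simp only [hs]
    split_ifs with h0
    · rw [abs_of_nonneg h0, one_mul]
    · rw [abs_of_neg (not_le.1 h0), neg_one_mul]
  rw [h1, expect_mul_fiberAvg c u s hsc]
  refine (le_abs_self _).trans (h.abs_expect_le huw hu s hsc fun x => ?_)
  simp only [hs]; split_ifs <;> simp

/-- The exceptional set of a partition: the cells on which the mean of `ν` is not within `τ`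
of `1`. -/
def exceptionalSet (c : X → ι) (ν : X → ℝ) (τ : ℝ) : Set X :=
  {x | τ < |fiberAvg c (fun y => ν y - 1) x|}

lemma exceptionalSet_indicator_congr (c : X → ι) (ν : X → ℝ) (τ : ℝ) {x y : X} (h : c x = c y) :
    (exceptionalSet c ν τ).indicator (1 : X → ℝ) x = (exceptionalSet c ν τ).indicator 1 y := by
  classical
  simp only [Set.indicator_apply, exceptionalSet, Set.mem_ofPred_eq, fiberAvg_congr c _ h,
    Pi.one_apply]

lemma expect_exceptionalSet_le (c : X → ι) (ν : X → ℝ) {τ κ : ℝ} (hτ : 0 < τ)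
    (hκ : 𝔼 x, |fiberAvg c (fun y => ν y - 1) x| ≤ κ) :
    𝔼 x, (exceptionalSet c ν τ).indicator (1 : X → ℝ) x ≤ κ / τ := by
  classical
  rw [le_div_iff₀ hτ, Finset.expect_mul]
  refine (Finset.expect_le_expect fun x _ => ?_).trans hκ
  simp only [Set.indicator_apply, exceptionalSet, Set.mem_ofPred_eq, Pi.one_apply]
  split_ifs with h
  · linarith
  · simp

/-- Write `ν = (ν - 1) + 1`: the first part is bounded by the `L¹` norm of the conditional
expectation, the second by Markov's inequality. -/
lemma expect_mul_exceptionalSet_le (c : X → ι) (ν : X → ℝ) {τ κ : ℝ} (hτ : 0 < τ)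
    (hκ : 𝔼 x, |fiberAvg c (fun y => ν y - 1) x| ≤ κ) :
    𝔼 x, ν x * (exceptionalSet c ν τ).indicator (1 : X → ℝ) x ≤ κ + κ / τ := by
  classical
  set b := (exceptionalSet c ν τ).indicator (1 : X → ℝ) with hb
  have h1 : 𝔼 x, ν x * b x = 𝔼 x, b x * (ν x - 1) + 𝔼 x, b x := by
    rw [← Finset.expect_add_distrib]
    exact Finset.expect_congr rfl fun x _ => by ring
  rw [h1, ← expect_mul_fiberAvg c (fun x => ν x - 1) b
    (fun x y h => exceptionalSet_indicator_congr c ν τ h)]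
  refine add_le_add (le_trans (Finset.expect_le_expect fun x _ => ?_) hκ)
    (expect_exceptionalSet_le c ν hτ hκ)
  simp only [hb, Set.indicator_apply]
  split_ifs
  · simpa using le_abs_self _
  · simp

/-! ### The energy increment and the structure theorem -/

/-- A convex function which is quadratic on `[0, 2]` and of linear growth. -/
def huber (x : ℝ) : ℝ := if x ≤ 2 then x ^ 2 else 4 * x - 4

lemma huber_le {x : ℝ} (hx : 0 ≤ x) : huber x ≤ 4 * x := by
  unfold huber; split_ifs with h <;> nlinarith

lemma huber_nonneg (x : ℝ) : 0 ≤ huber x := by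
  unfold huber; split_ifs with h <;> nlinarith

/-- Convexity: the graph lies above its tangent at `x`, of slope `2 * min x 2` (for `x ≤ 2` the
square is used). -/
lemma huber_bregman (x y : ℝ) :
    0 ≤ huber y - huber x - 2 * min x 2 * (y - x) := by
  unfold huber
  by_cases hx : x ≤ 2 <;> by_cases hy : y ≤ 2
  · rw [if_pos hx, if_pos hy, min_eq_left hx]; nlinarith [sq_nonneg (y - x)]
  · rw [if_pos hx, if_neg hy, min_eq_left hx]; nlinarith [sq_nonneg (x - 2)]
  · rw [if_neg hx, if_pos hy, min_eq_right (not_le.1 hx).le]; nlinarith [sq_nonneg (y - 2)]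
  · rw [if_neg hx, if_neg hy, min_eq_right (not_le.1 hx).le]; linarith

lemma huber_bregman_of_le {x y : ℝ} (hx : x ≤ 2) (hy : y ≤ 2) :
    (y - x) ^ 2 = huber y - huber x - 2 * min x 2 * (y - x) := by
  unfold huber
  rw [if_pos hx, if_pos hy, min_eq_left hx]; ring

/-- The energy of `f` relative to a partition. -/
def energy (c : X → ι) (f : X → ℝ) : ℝ := 𝔼 x, huber (fiberAvg c f x)

lemma energy_le (c : X → ι) {f : X → ℝ} (hf : ∀ x, 0 ≤ f x) : energy c f ≤ 4 * 𝔼 x, f x := by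
  rw [← expect_fiberAvg c f, Finset.mul_expect]
  exact Finset.expect_le_expect fun x _ => huber_le (fiberAvg_nonneg c hf x)

lemma energy_nonneg (c : X → ι) (f : X → ℝ) : 0 ≤ energy c f :=
  Finset.expect_nonneg fun _ _ => huber_nonneg _

lemma fiberAvg_le_two (c : X → ι) {ν f : X → ℝ} (hfν : ∀ x, f x ≤ ν x) {τ : ℝ} (hτ : τ ≤ 1)
    {x : X} (hx : x ∉ exceptionalSet c ν τ) : fiberAvg c f x ≤ 2 := by
  have h1 : |fiberAvg c (fun y => ν y - 1) x| ≤ τ := not_lt.1 hx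
  rw [fiberAvg_sub_one] at h1
  linarith [fiberAvg_mono c hfν x, (abs_le.1 h1).2]

/-- Up to errors `ε / 4` each, `φ` may be made constant on the fine cells, which turns `f` into
`g'`, and the new exceptional cells may be dropped. What is left says that `|g' - g|` has mean at
least `ε / 2` over points where both averages are at most `2`. There the Bregman divergence of
`huber` is `(g' - g)²`; elsewhere it is nonnegative, and its mean is the energy gain. -/
lemma energy_increment [Nonempty X] (c : X → ι) (c' : X → ι')
    (href : ∀ x y, c' x = c' y → c x = c y)
    {ν f φ : X → ℝ} (hf : ∀ x, 0 ≤ f x) (hfν : ∀ x, f x ≤ ν x) (hν : 𝔼 x, ν x ≤ 2)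
    {τ κ ε σ : ℝ} (hτ : 0 < τ) (hτ1 : τ ≤ 1) (hε : 0 < ε)
    (hκ' : 𝔼 x, |fiberAvg c' (fun y => ν y - 1) x| ≤ κ)
    (hφ : ∀ x, |φ x| ≤ 1) (hσ : ∀ x y, c' x = c' y → |φ x - φ y| ≤ σ)
    (hσε : 4 * σ ≤ ε / 4) (hκε : κ + 3 * (κ / τ) ≤ ε / 4)
    (hcorr : ε < |𝔼 x, (1 - (exceptionalSet c ν τ).indicator 1 x) *
      (f x - fiberAvg c f x) * φ x|) :
    energy c f + ε ^ 2 / 4 ≤ energy c' f := by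
  classical
  set g := fiberAvg c f with hg
  set g' := fiberAvg c' f with hg'
  set a : X → ℝ := fun x => 1 - (exceptionalSet c ν τ).indicator 1 x with ha
  set b : X → ℝ := (exceptionalSet c' ν τ).indicator 1 with hb
  have hg0 : ∀ x, 0 ≤ g x := fiberAvg_nonneg c hf
  have hg0' : ∀ x, 0 ≤ g' x := fiberAvg_nonneg c' hf
  have hac : ∀ x y, c x = c y → a x = a y := fun x y h => by
    simp only [ha, exceptionalSet_indicator_congr c ν τ h]
  have hbc : ∀ x y, c' x = c' y → b x = b y := fun x y h =>
    exceptionalSet_indicator_congr c' ν τ h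
  have ha01 : ∀ x, (a x = 0) ∨ (a x = 1 ∧ g x ≤ 2) := by
    intro x
    by_cases hx : x ∈ exceptionalSet c ν τ
    · left; simp [ha, hx]
    · right; exact ⟨by simp [ha, hx], fiberAvg_le_two c hfν hτ1 hx⟩
  have hb01 : ∀ x, (b x = 1) ∨ (b x = 0 ∧ g' x ≤ 2) := by
    intro x
    by_cases hx : x ∈ exceptionalSet c' ν τ
    · left; simp [hb, hx]
    · right; exact ⟨by simp [hb, hx], fiberAvg_le_two c' hfν hτ1 hx⟩
  set φ' : X → ℝ := fun x => φ (Function.invFun c' (c' x)) with hφ'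
  have hφ'c : ∀ x y, c' x = c' y → φ' x = φ' y := fun x y h => by simp only [hφ', h]
  have hφφ' : ∀ x, |φ x - φ' x| ≤ σ := fun x =>
    hσ _ _ (Function.invFun_eq (f := c') ⟨x, rfl⟩).symm
  have hEf : 𝔼 x, f x ≤ 2 := (Finset.expect_le_expect fun x _ => hfν x).trans hν
  have hσ0 : 0 ≤ σ := (abs_nonneg _).trans (hσ (Classical.arbitrary X) _ rfl)
  have hpart1 : |𝔼 x, a x * (f x - g x) * (φ x - φ' x)| ≤ ε / 4 := by
    refine (Finset.abs_expect_le _ _).trans ?_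
    have h1 : 𝔼 x, |a x * (f x - g x) * (φ x - φ' x)| ≤ 𝔼 x, (f x + g x) * σ := by
      refine Finset.expect_le_expect fun x _ => ?_
      rw [abs_mul]
      refine mul_le_mul ?_ (hφφ' x) (abs_nonneg _) (add_nonneg (hf x) (hg0 x))
      have h2 : |f x - g x| ≤ f x + g x := by
        rw [abs_le]; constructor <;> linarith [hf x, hg0 x]
      rcases ha01 x with h | ⟨h, -⟩
      · rw [h, zero_mul, abs_zero]; exact add_nonneg (hf x) (hg0 x)
      · rwa [h, one_mul]
    refine h1.trans ?_
    rw [← Finset.expect_mul, Finset.expect_add_distrib, hg, expect_fiberAvg]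
    nlinarith
  have hpart2 : 𝔼 x, a x * (f x - g x) * φ' x = 𝔼 x, a x * (g' x - g x) * φ' x := by
    have h1 := expect_mul_fiberAvg c' f (fun x => a x * φ' x)
      (fun x y h => by simp only [hac x y (href x y h), hφ'c x y h])
    have h2 : ∀ F : X → ℝ, 𝔼 x, a x * (F x - g x) * φ' x =
        𝔼 x, a x * φ' x * F x - 𝔼 x, a x * φ' x * g x := fun F => by
      rw [← Finset.expect_sub_distrib]
      exact Finset.expect_congr rfl fun x _ => by ring
    rw [h2, h2, ← h1]
  have hsplit : 𝔼 x, a x * (f x - g x) * φ x =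
      𝔼 x, a x * (f x - g x) * (φ x - φ' x) + 𝔼 x, a x * (g' x - g x) * φ' x := by
    rw [← hpart2, ← Finset.expect_add_distrib]
    exact Finset.expect_congr rfl fun x _ => by ring
  have hbf : 𝔼 x, b x * g' x ≤ κ + κ / τ := by
    rw [hg', expect_mul_fiberAvg c' f b hbc]
    refine le_trans (Finset.expect_le_expect fun x _ => ?_) (expect_mul_exceptionalSet_le c' ν hτ hκ')
    rw [mul_comm]
    refine mul_le_mul_of_nonneg_right (hfν x) ?_
    rcases hb01 x with h | ⟨h, -⟩ <;> rw [h]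
    exact zero_le_one
  have hb1 : 𝔼 x, b x ≤ κ / τ := expect_exceptionalSet_le c' ν hτ hκ'
  set d : X → ℝ := fun x => a x * (1 - b x) * |g' x - g x| with hd
  have hpart3 : |𝔼 x, a x * (g' x - g x) * φ' x| ≤ 𝔼 x, d x + ε / 4 := by
    refine (Finset.abs_expect_le _ _).trans ?_
    -- On new exceptional cells `|g' - g| ≤ g' + g`, with `g ≤ 2` wherever `a ≠ 0`.
    have h1 : 𝔼 x, |a x * (g' x - g x) * φ' x| ≤ 𝔼 x, (d x + b x * g' x + 2 * b x) := by
      refine Finset.expect_le_expect fun x _ => ?_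
      rw [abs_mul]
      refine (mul_le_of_le_one_right (abs_nonneg _) (hφ _)).trans ?_
      have h2 : |g' x - g x| ≤ g' x + g x := by
        rw [abs_le]; constructor <;> linarith [hg0' x, hg0 x]
      have h3 := hg0' x
      simp only [hd]
      rcases ha01 x with h | ⟨h, hgx⟩ <;> rcases hb01 x with h' | ⟨h', hgx'⟩ <;> rw [h, h'] <;>
        norm_num <;> linarith
    refine h1.trans ?_
    rw [Finset.expect_add_distrib, Finset.expect_add_distrib, ← Finset.mul_expect]
    linarith
  have hd2 : ε / 2 ≤ 𝔼 x, d x := by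
    rw [hsplit] at hcorr
    linarith [abs_add_le (𝔼 x, a x * (f x - g x) * (φ x - φ' x)) (𝔼 x, a x * (g' x - g x) * φ' x)]
  have hdsq : (ε / 2) ^ 2 ≤ 𝔼 x, d x ^ 2 := by
    have h1 := Finset.expect_mul_sq_le_sq_mul_sq Finset.univ d (fun _ => (1 : ℝ))
    simp only [mul_one, one_pow, Fintype.expect_one] at h1
    exact (pow_le_pow_left₀ (by positivity) hd2 2).trans h1
  have hbreg : 𝔼 x, d x ^ 2 ≤ energy c' f - energy c f := by
    -- The slope is constant on coarse cells, where `g` and `g'` have the same mean.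
    have h1 : 𝔼 x, 2 * min (g x) 2 * (g' x - g x) = 0 := by
      have h2 := expect_mul_fiberAvg c' f (fun x => 2 * min (g x) 2)
        (fun x y h => by simp only [hg, fiberAvg_congr c f (href x y h)])
      have h3 := expect_mul_fiberAvg c f (fun x => 2 * min (g x) 2)
        (fun x y h => by simp only [hg, fiberAvg_congr c f h])
      simp only [mul_sub, Finset.expect_sub_distrib]
      rw [h2, h3, sub_self]
    have h4 : energy c' f - energy c f =
        𝔼 x, (huber (g' x) - huber (g x) - 2 * min (g x) 2 * (g' x - g x)) := by
      rw [Finset.expect_sub_distrib, Finset.expect_sub_distrib, h1, sub_zero]; rfl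
    rw [h4]
    refine Finset.expect_le_expect fun x _ => ?_
    have h5 := huber_bregman (g x) (g' x)
    simp only [hd]
    rcases ha01 x with h | ⟨h, hgx⟩
    · rw [h]; simpa using h5
    · rcases hb01 x with h' | ⟨h', hgx'⟩
      · rw [h, h']; simpa using h5
      · rw [h, h', sub_zero, one_mul, one_mul, sq_abs]
        exact (huber_bregman_of_le hgx hgx').le
  linarith

end Partition

/-- The structure theorem: a function dominated by a weight which does not correlate with a test
class has a conditional expectation indistinguishable from it by the test class, outside of an
exceptional set. -/
theorem exists_partition (ε τ κ : ℝ) (hε : 0 < ε) (hτ : 0 < τ) (hτ1 : τ ≤ 1) (hκ : 0 < κ) :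
    ∃ θ : ℝ, 0 < θ ∧ ∀ (X : Type) [Fintype X] [Nonempty X] (𝒟 : Set (X → ℝ)), IsTestClass 𝒟 →
      ∀ ν f : X → ℝ, (∀ x, 0 ≤ f x) → (∀ x, f x ≤ ν x) →
        (∀ φ ∈ 𝒟, |𝔼 x, (ν x - 1) * φ x| ≤ θ) →
        ∃ (ι : Type) (c : X → ι), 𝔼 x, |fiberAvg c (fun y => ν y - 1) x| ≤ κ ∧
          ∀ φ ∈ 𝒟, |𝔼 x, (1 - (exceptionalSet c ν τ).indicator 1 x) *
            (f x - fiberAvg c f x) * φ x| ≤ ε := by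
  obtain ⟨s, hs⟩ := exists_nat_gt (16 / ε)
  have hs0 : (0 : ℝ) < s := (by positivity : (0 : ℝ) < 16 / ε).trans hs
  have hsn : 0 < s := by exact_mod_cast hs0
  -- The energy is at most `8` and gains `ε ^ 2 / 4` per round, so `T` rounds are impossible.
  obtain ⟨T, hT⟩ := exists_nat_gt (8 / (ε ^ 2 / 4))
  set κ₁ : ℝ := min (κ / 2) (ε * τ / 32) with hκ₁
  have hκ₁0 : 0 < κ₁ := by positivity
  have hκ₁ε : 2 * κ₁ + 3 * (2 * κ₁ / τ) ≤ ε / 4 := by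
    have h1 : κ₁ ≤ ε * τ / 32 := min_le_right _ _
    have h2 : 2 * κ₁ / τ ≤ ε / 16 := by rw [div_le_iff₀ hτ]; linarith
    have h3 : 2 * κ₁ ≤ ε / 16 := by nlinarith
    linarith
  set J : ℕ := 2 * s + 2 with hJ
  have hJ1 : (1 : ℝ) ≤ J := by exact_mod_cast (by omega : 1 ≤ J)
  -- A round turns an error `κ' ≥ κ₀` into at most `J * (2 * κ' + κ₀) ≤ 4 * J * κ'`.
  set κ₀ : ℝ := κ₁ / (4 * J) ^ T with hκ₀
  have hκ₀0 : 0 < κ₀ := by positivity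
  obtain ⟨M₀, hM₀, hlevel⟩ := exists_level_sets s hsn κ₀ hκ₀0
  set M := max 1 M₀ with hM
  have hM1 : 1 ≤ M := le_max_left _ _
  -- At most `J ^ T` cells, each with approximant of dual norm at most `M ^ T`, contribute at most
  -- `κ₁`; the bound `1` gives `𝔼 ν ≤ 2`.
  refine ⟨min 1 (κ₁ / ((J : ℝ) ^ T * M ^ T)), by positivity, ?_⟩
  set θ := min 1 (κ₁ / ((J : ℝ) ^ T * M ^ T)) with hθ
  have hθ0 : 0 < θ := by positivity
  intro X _ _ 𝒟 h𝒟 ν f hf hfν hνθ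
  have hν0 : ∀ x, 0 ≤ ν x := fun x => (hf x).trans (hfν x)
  have hν2 : 𝔼 x, ν x ≤ 2 := by
    have h1 := hνθ _ h𝒟.one_mem
    simp only [mul_one, Finset.expect_sub_distrib, Fintype.expect_one] at h1
    linarith [(abs_le.1 h1).2, min_le_left 1 (κ₁ / ((J : ℝ) ^ T * M ^ T))]
  set w : X → ℝ := fun x => ν x + 1 with hw
  have hw0 : ∀ x, 0 ≤ w x := fun x => by linarith [hν0 x]
  have hw4 : 𝔼 x, w x ≤ 4 := by
    rw [Finset.expect_add_distrib, Fintype.expect_one]; linarith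
  have huw : ∀ x, |ν x - 1| ≤ w x := fun x => by
    rw [abs_le]; constructor <;> linarith [hν0 x]
  have hsmall : ∀ (n : ℕ), n ≤ T → ∀ (ι : Type) [Fintype ι] [DecidableEq ι] (c : X → ι),
      Fintype.card ι = J ^ n → Approximable 𝒟 w c ((4 * J) ^ n * κ₀) (M ^ n) →
      𝔼 x, |fiberAvg c (fun y => ν y - 1) x| ≤ 2 * κ₁ := by
    intro n hn ι _ _ c hcard happ
    refine (happ.expect_abs_fiberAvg_le huw hνθ).trans ?_
    have h1 : (4 * (J : ℝ)) ^ n * κ₀ ≤ κ₁ := by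
      calc (4 * (J : ℝ)) ^ n * κ₀ ≤ (4 * J) ^ T * κ₀ :=
            mul_le_mul_of_nonneg_right (pow_le_pow_right₀ (by linarith) hn) hκ₀0.le
        _ = κ₁ := by rw [hκ₀]; field_simp
    have h2 : (Fintype.card ι : ℝ) * (M ^ n * θ) ≤ κ₁ := by
      rw [hcard]; push_cast
      calc (J : ℝ) ^ n * (M ^ n * θ) ≤ (J : ℝ) ^ T * (M ^ T * θ) := by
            gcongr
        _ ≤ (J : ℝ) ^ T * (M ^ T * (κ₁ / ((J : ℝ) ^ T * M ^ T))) := by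
            gcongr; exact min_le_right _ _
        _ = κ₁ := by field_simp
    linarith
  by_contra! hcon
  have hiter : ∀ n : ℕ, n ≤ T → ∃ (ι : Type) (_ : Fintype ι) (_ : DecidableEq ι) (c : X → ι),
      Fintype.card ι = J ^ n ∧ Approximable 𝒟 w c ((4 * J) ^ n * κ₀) (M ^ n) ∧
      n * (ε ^ 2 / 4) ≤ energy c f := by
    intro n
    induction n with
    | zero =>
      intro _
      refine ⟨Unit, inferInstance, inferInstance, fun _ => (), by simp, ⟨fun _ _ => 1, ?_, ?_⟩, ?_⟩
      · intro _
        simpa using IsTestClass.dualBound_of_mem h𝒟.one_mem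
      · simpa using hκ₀0.le
      · simpa using energy_nonneg _ _
    | succ n ih =>
      intro hn
      obtain ⟨ι, _, _, c, hcard, happ, hen⟩ := ih (by omega)
      have hL1 := hsmall n (by omega) ι c hcard happ
      obtain ⟨φ, hφ, hcorr⟩ := hcon ι c (hL1.trans (by linarith [min_le_left (κ / 2) (ε * τ / 32)]))
      obtain ⟨c', p, hdiam, hpM, hpκ, hp2⟩ := hlevel X w φ hw0 hw4 (h𝒟.abs_le_one φ hφ)
      have happ' : Approximable 𝒟 w (fun x => (c x, c' x)) ((4 * J) ^ (n + 1) * κ₀)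
          (M ^ (n + 1)) := by
        rw [pow_succ M]
        refine (happ.prod h𝒟 hw0 (fun m x => (p m).eval (φ x))
          (fun m => (DualBound.polynomial h𝒟 hφ (p m)).mono h𝒟
            ((hpM m).trans (le_max_right _ _))) hp2 hpκ).mono ?_
        rw [Fintype.card_fin, pow_succ]
        have h1 : κ₀ ≤ (4 * (J : ℝ)) ^ n * κ₀ :=
          le_mul_of_one_le_left hκ₀0.le (one_le_pow₀ (by linarith))
        change (J : ℝ) * _ ≤ _
        nlinarith
      have hcard' : Fintype.card (ι × Fin J) = J ^ (n + 1) := by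
        rw [Fintype.card_prod, hcard, Fintype.card_fin, pow_succ]
      refine ⟨ι × Fin J, inferInstance, inferInstance, fun x => (c x, c' x), hcard', happ', ?_⟩
      have hσε : 4 * (1 / (s : ℝ)) ≤ ε / 4 := by
        rw [div_lt_iff₀ hε] at hs
        rw [mul_one_div, div_le_div_iff₀ hs0 (by norm_num)]; linarith
      have := energy_increment c (fun x => (c x, c' x)) (fun x y h => (Prod.ext_iff.1 h).1) hf hfν
        hν2 hτ hτ1 hε (hsmall (n + 1) hn _ _ hcard' happ') (h𝒟.abs_le_one φ hφ)
        (fun x y h => hdiam x y (Prod.ext_iff.1 h).2) hσε hκ₁ε hcorr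
      push_cast
      linarith
  obtain ⟨ι, _, _, c, -, -, hen⟩ := hiter T le_rfl
  have h1 := energy_le c hf
  have h2 : 𝔼 x, f x ≤ 2 := (Finset.expect_le_expect fun x _ => hfν x).trans hν2
  rw [div_lt_iff₀ (by positivity)] at hT
  linarith

set_option linter.unusedSectionVars false

/-! ### Cube averages, dual functions and densification -/

section Cube

variable {I : Type} [Fintype I] [DecidableEq I] {G : Type} [AddCommGroup G] [Fintype G]

/-- The vertex `ω · h` of the cube with sides `h`. -/
def vertex (ω : I → Bool) (h : I → G) : G := ∑ i, if ω i then h i else 0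

/-- The average of a family of functions over all cubes, one function at each vertex. -/
def cubeAvg (g : (I → Bool) → G → ℝ) : ℝ := 𝔼 x, 𝔼 h : I → G, ∏ ω, g ω (x + vertex ω h)

/-- The dual function: the average over all cubes at a given point, leaving out that point. -/
def dualFn (g : (I → Bool) → G → ℝ) (x : G) : ℝ :=
  𝔼 h : I → G, ∏ ω, if ω = (fun _ => false) then 1 else g ω (x + vertex ω h)

@[simp] lemma vertex_false (h : I → G) : vertex (fun _ => false) h = 0 := by simp [vertex]

lemma vertex_add (ω : I → Bool) (h h' : I → G) : vertex ω (h + h') = vertex ω h + vertex ω h' := by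
  simp only [vertex, ← Finset.sum_add_distrib]
  exact Finset.sum_congr rfl fun i _ => by split_ifs <;> simp

lemma vertex_single (ω : I → Bool) (i : I) (s : G) :
    vertex ω (Pi.single i s) = if ω i then s else 0 := by
  unfold vertex
  rw [Finset.sum_eq_single i]
  · simp
  · intro j _ hj; simp [hj]
  · simp

lemma vertex_update_false (ω : I → Bool) (i : I) (h : I → G) :
    vertex (Function.update ω i false) h + (if ω i then h i else 0) = vertex ω h := by
  unfold vertex
  rw [← Finset.add_sum_erase _ _ (Finset.mem_univ i),
    ← Finset.add_sum_erase Finset.univ (fun j => if ω j then h j else 0) (Finset.mem_univ i)]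
  rw [Function.update_self, add_comm]
  simp only [Bool.false_eq_true, if_false, zero_add]
  congr 1
  refine Finset.sum_congr rfl fun j hj => ?_
  rw [Function.update_of_ne (Finset.ne_of_mem_erase hj)]

lemma expect_add_right (F : G → ℝ) (s : G) : 𝔼 x, F (x + s) = 𝔼 x, F x :=
  Fintype.expect_equiv (Equiv.addRight s) _ _ fun _ => rfl

lemma cubeAvg_eq (g : (I → Bool) → G → ℝ) :
    cubeAvg g = 𝔼 x, g (fun _ => false) x * dualFn g x := by
  unfold cubeAvg dualFn
  refine Finset.expect_congr rfl fun x _ => ?_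
  rw [Finset.mul_expect]
  refine Finset.expect_congr rfl fun h _ => ?_
  have h1 : ∀ ω : I → Bool, g ω (x + vertex ω h) =
      (if ω = (fun _ => false) then g (fun _ => false) x else 1) *
      (if ω = (fun _ => false) then 1 else g ω (x + vertex ω h)) := by
    intro ω
    split_ifs with h0
    · subst h0; simp
    · simp
  rw [Finset.prod_congr rfl fun ω _ => h1 ω, Finset.prod_mul_distrib,
    Finset.prod_ite_eq' Finset.univ (fun _ => false), if_pos (Finset.mem_univ _)]

lemma dualFn_congr {g g' : (I → Bool) → G → ℝ} (h : ∀ ω ≠ (fun _ => false), g ω = g' ω) (x : G) :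
    dualFn g x = dualFn g' x := by
  unfold dualFn
  refine Finset.expect_congr rfl fun t _ => Finset.prod_congr rfl fun ω _ => ?_
  split_ifs with h0
  · rfl
  · rw [h ω h0]

lemma abs_dualFn_le {g : (I → Bool) → G → ℝ} {W : (I → Bool) → G → ℝ}
    (h : ∀ ω x, |g ω x| ≤ W ω x) (x : G) : |dualFn g x| ≤ dualFn W x := by
  refine (Finset.abs_expect_le _ _).trans (Finset.expect_le_expect fun t _ => ?_)
  rw [Finset.abs_prod]
  refine Finset.prod_le_prod (fun _ _ => abs_nonneg _) fun ω _ => ?_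
  split_ifs
  · simp
  · exact h ω _

lemma abs_cubeAvg_le {g : (I → Bool) → G → ℝ} {W : (I → Bool) → G → ℝ}
    (h : ∀ ω x, |g ω x| ≤ W ω x) : |cubeAvg g| ≤ cubeAvg W := by
  refine (Finset.abs_expect_le _ _).trans (Finset.expect_le_expect fun x _ => ?_)
  refine (Finset.abs_expect_le _ _).trans (Finset.expect_le_expect fun t _ => ?_)
  rw [Finset.abs_prod]
  exact Finset.prod_le_prod (fun _ _ => abs_nonneg _) fun ω _ => h ω _

/-- The factor by which `dualFn` scales under multiplication of all functions by `C`. -/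
def dualScale (I : Type) [Fintype I] [DecidableEq I] (C : ℝ) : ℝ :=
  ∏ ω : I → Bool, if ω = (fun _ => false) then 1 else C

lemma one_le_dualScale {C : ℝ} (hC : 1 ≤ C) : 1 ≤ dualScale I C := by
  unfold dualScale
  refine Finset.prod_induction _ (fun a => (1 : ℝ) ≤ a)
    (fun a b ha hb => one_le_mul_of_one_le_of_one_le ha hb) le_rfl fun ω _ => ?_
  split_ifs
  · exact le_rfl
  · exact hC

lemma dualFn_const_mul (C : ℝ) (g : (I → Bool) → G → ℝ) (x : G) :
    dualFn (fun ω y => C * g ω y) x = dualScale I C * dualFn g x := by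
  unfold dualFn dualScale
  rw [Finset.mul_expect]
  refine Finset.expect_congr rfl fun t _ => ?_
  rw [← Finset.prod_mul_distrib]
  exact Finset.prod_congr rfl fun ω _ => by split_ifs <;> simp

/-! ### The Cauchy--Schwarz inequality -/

/-- The product over one of the two faces of the cube orthogonal to the direction `i`. -/
def faceProd (g : (I → Bool) → G → ℝ) (i : I) (b : Bool) (x : G) (h : I → G) : ℝ :=
  ∏ ω with ω i = b, g ω (x + vertex ω h)

/-- Averaging over an extra shift `s` of `h i` changes nothing; it translates one face and fixes the
other, so their base points become independent. -/
lemma cubeAvg_eq_face (g : (I → Bool) → G → ℝ) (i : I) :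
    cubeAvg g = 𝔼 h : I → G, (𝔼 x, faceProd g i false x h) * 𝔼 x, faceProd g i true x h := by
  have h1 : ∀ x : G, ∀ h : I → G, ∀ s : G, ∏ ω, g ω (x + vertex ω (h + Pi.single i s)) =
      faceProd g i false x h * faceProd g i true (x + s) h := by
    intro x h s
    have hf : (Finset.univ.filter fun ω : I → Bool => ¬ ω i = true) =
        Finset.univ.filter fun ω => ω i = false := by ext; simp
    rw [← Finset.prod_filter_mul_prod_filter_not Finset.univ (fun ω : I → Bool => ω i = true),
      mul_comm, hf]
    unfold faceProd
    congr 1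
    · refine Finset.prod_congr rfl fun ω hω => ?_
      have : ω i = false := by simpa using hω
      rw [vertex_add, vertex_single, this]; simp
    · refine Finset.prod_congr rfl fun ω hω => ?_
      have : ω i = true := by simpa using hω
      rw [vertex_add, vertex_single, this, if_pos rfl, ← add_assoc, add_right_comm]
  have h2 : ∀ x : G, 𝔼 h : I → G, ∏ ω, g ω (x + vertex ω h) =
      𝔼 s : G, 𝔼 h : I → G, faceProd g i false x h * faceProd g i true (x + s) h := by
    intro x
    rw [← Fintype.expect_const (ι := G) (𝔼 h : I → G, ∏ ω, g ω (x + vertex ω h))]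
    refine Finset.expect_congr rfl fun s _ => ?_
    rw [← expect_add_right (G := I → G) _ (Pi.single i s)]
    exact Finset.expect_congr rfl fun h _ => h1 x h s
  unfold cubeAvg
  simp only [h2]
  have h3 : ∀ x : G, 𝔼 s : G, 𝔼 h : I → G, faceProd g i false x h * faceProd g i true (x + s) h =
      𝔼 h : I → G, faceProd g i false x h * 𝔼 y, faceProd g i true y h := by
    intro x
    rw [Finset.expect_comm]
    refine Finset.expect_congr rfl fun h _ => ?_
    rw [← Finset.mul_expect, ← expect_add_right (fun y => faceProd g i true y h) x]
    simp only [add_comm x]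
  simp only [h3]
  rw [Finset.expect_comm]
  refine Finset.expect_congr rfl fun h _ => ?_
  rw [Finset.expect_mul]

/-- Opposite faces differ by the translation `h i`, absorbed by the average over `x`. -/
lemma expect_faceProd_update (g : (I → Bool) → G → ℝ) (i : I) (b b' : Bool) (h : I → G) :
    𝔼 x, faceProd (fun ω => g (Function.update ω i b)) i b' x h = 𝔼 x, faceProd g i b x h := by
  have hv : ∀ (ω : I → Bool), ω i = b' →
      vertex ω h = vertex (Function.update ω i b) h +
        ((if b' then h i else 0) - (if b then h i else 0)) := by
    intro ω hω
    have h1 := vertex_update_false ω i h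
    have h2 := vertex_update_false (Function.update ω i b) i h
    rw [Function.update_idem, Function.update_self] at h2
    rw [hω] at h1
    rw [← h1, ← h2]; abel
  rw [← expect_add_right (fun x => faceProd g i b x h)
    ((if b' then h i else 0) - (if b then h i else 0))]
  refine Finset.expect_congr rfl fun x _ => ?_
  unfold faceProd
  refine Finset.prod_nbij' (fun ω => Function.update ω i b) (fun ω => Function.update ω i b')
    ?_ ?_ ?_ ?_ ?_
  · intro ω _; simp
  · intro ω _; simp
  · intro ω hω
    have : ω i = b' := by simpa using hω
    rw [Function.update_idem, ← this, Function.update_eq_self]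
  · intro ω hω
    have : ω i = b := by simpa using hω
    rw [Function.update_idem, ← this, Function.update_eq_self]
  · intro ω hω
    have : ω i = b' := by simpa using hω
    rw [hv ω this]
    congr 1; abel

lemma cubeAvg_sq_le (g : (I → Bool) → G → ℝ) (i : I) :
    cubeAvg g ^ 2 ≤ cubeAvg (fun ω => g (Function.update ω i false)) *
      cubeAvg (fun ω => g (Function.update ω i true)) := by
  rw [cubeAvg_eq_face g i, cubeAvg_eq_face (fun ω => g (Function.update ω i false)) i,
    cubeAvg_eq_face (fun ω => g (Function.update ω i true)) i]
  simp only [expect_faceProd_update, ← pow_two]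
  exact Finset.expect_mul_sq_le_sq_mul_sq _ _ _

/-- Iterated Cauchy–Schwarz. The set `t` holds the directions still to be treated: a step in
direction `i` copies the face `ω i = false` onto its opposite, and the other factor is at most `B`.
For `t = univ` only the origin must carry `u`; for `t = ∅` every vertex does. -/
lemma abs_cubeAvg_small (B : ℝ) (hB : 1 ≤ B) (t : Finset I) : ∀ ε : ℝ, 0 < ε → ∃ θ : ℝ, 0 < θ ∧
    ∀ (G : Type) [AddCommGroup G] [Fintype G] (u W : G → ℝ), (∀ x, |u x| ≤ W x) →
      cubeAvg (fun _ : I → Bool => W) ≤ B → |cubeAvg (fun _ : I → Bool => u)| ≤ θ →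
      ∀ g : (I → Bool) → G → ℝ, (∀ ω x, |g ω x| ≤ W x) →
        (∀ ω, (∀ i ∈ t, ω i = false) → g ω = u) → |cubeAvg g| ≤ ε := by
  induction t using Finset.induction_on with
  | empty =>
    intro ε hε
    refine ⟨ε, hε, fun G _ _ u W _ _ hu g _ hg => ?_⟩
    have : g = fun _ => u := funext fun ω => hg ω (by simp)
    rwa [this]
  | insert i t _ ih =>
    intro ε hε
    obtain ⟨θ, hθ, h⟩ := ih (ε ^ 2 / B) (by positivity)
    refine ⟨θ, hθ, fun G _ _ u W huW hW hu g hgW hg => ?_⟩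
    have h1 := h G u W huW hW hu (fun ω => g (Function.update ω i false)) (fun ω x => hgW _ x)
      (fun ω hω => hg _ fun j hj => by
        by_cases hji : j = i
        · rw [hji, Function.update_self]
        · rw [Function.update_of_ne hji]
          exact hω j ((Finset.mem_insert.1 hj).resolve_left hji))
    have h2 := (abs_cubeAvg_le (g := fun ω => g (Function.update ω i true)) (W := fun _ => W)
      (fun ω x => hgW _ x)).trans hW
    have h3 := cubeAvg_sq_le g i
    refine abs_le_of_sq_le_sq (h3.trans ?_) hε.le
    refine (le_abs_self _).trans ?_
    rw [abs_mul]
    calc _ ≤ ε ^ 2 / B * B := mul_le_mul h1 h2 (abs_nonneg _) (by positivity)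
      _ = ε ^ 2 := by field_simp

/-! ### Symmetries and products -/

/-- The reflection of the cube `{0,1}^I` that exchanges `ω₀` and `0`. -/
def reflect (ω₀ : I → Bool) : (I → Bool) ≃ (I → Bool) where
  toFun ω i := xor (ω i) (ω₀ i)
  invFun ω i := xor (ω i) (ω₀ i)
  left_inv ω := by ext i; simp
  right_inv ω := by ext i; simp

lemma reflect_false (ω₀ : I → Bool) : reflect ω₀ (fun _ => false) = ω₀ := by
  ext i; simp [reflect]

lemma vertex_reflect (ω₀ ω : I → Bool) (h : I → G) :
    vertex (reflect ω₀ ω) h = vertex ω₀ h + vertex ω (fun i => if ω₀ i then -h i else h i) := by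
  simp only [vertex, ← Finset.sum_add_distrib]
  refine Finset.sum_congr rfl fun i _ => ?_
  cases h1 : ω i <;> cases h2 : ω₀ i <;> simp [reflect, h1, h2]

/-- Any vertex can serve as base point, after a translation of `x` and a change of sign of the sides
in `ω₀`. -/
lemma cubeAvg_reflect (g : (I → Bool) → G → ℝ) (ω₀ : I → Bool) :
    cubeAvg (fun ω => g (reflect ω₀ ω)) = cubeAvg g := by
  unfold cubeAvg
  have h1 : ∀ (x : G) (h : I → G), ∏ ω, g (reflect ω₀ ω) (x + vertex ω h) =
      ∏ ω, g ω (x + vertex ω₀ h + vertex ω (fun i => if ω₀ i then -h i else h i)) := by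
    intro x h
    refine Fintype.prod_equiv (reflect ω₀) _ _ fun ω => ?_
    congr 1
    have h2 : reflect ω₀ (reflect ω₀ ω) = ω := (reflect ω₀).left_inv ω
    rw [add_assoc, ← vertex_reflect, h2]
  simp only [h1]
  rw [Finset.expect_comm, Finset.expect_comm (f := fun x h => ∏ ω, g ω (x + vertex ω h))]
  have h3 : ∀ h : I → G, 𝔼 x, ∏ ω, g ω (x + vertex ω₀ h +
      vertex ω (fun i => if ω₀ i then -h i else h i)) =
      𝔼 x, ∏ ω, g ω (x + vertex ω (fun i => if ω₀ i then -h i else h i)) := fun h =>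
    expect_add_right (fun x => ∏ ω, g ω (x + vertex ω (fun i => if ω₀ i then -h i else h i))) _
  simp only [h3]
  refine Fintype.expect_bijective (fun (h : I → G) i => if ω₀ i then -h i else h i) ?_ _ _
    fun _ => rfl
  refine Function.Involutive.bijective fun h => ?_
  ext i
  by_cases h0 : ω₀ i <;> simp [h0]

/-- Two systems on cubes glued into one on a cube of twice the dimension, with a common vertex. -/
def glue (g g' : (I → Bool) → G → ℝ) (ω : I ⊕ I → Bool) : G → ℝ :=
  if (ω ∘ Sum.inl) = (fun _ => false) then g' (ω ∘ Sum.inr)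
  else if (ω ∘ Sum.inr) = (fun _ => false) then g (ω ∘ Sum.inl) else fun _ => 1

lemma abs_glue_le {g g' : (I → Bool) → G → ℝ} {x : G} {C : ℝ} (hC : 1 ≤ C)
    (h : ∀ ω, |g ω x| ≤ C) (h' : ∀ ω, |g' ω x| ≤ C) (ω : I ⊕ I → Bool) : |glue g g' ω x| ≤ C := by
  unfold glue
  split_ifs
  · exact h' _
  · exact h _
  · simpa using hC

lemma prod_prod_cross {A B : Type} [Fintype A] [Fintype B] [DecidableEq A] [DecidableEq B]
    (a₀ : A) (b₀ : B) (P : A → ℝ) (Q : B → ℝ) :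
    ∏ ab : A × B, (if ab.1 = a₀ then (if ab.2 = b₀ then 1 else Q ab.2) else
      if ab.2 = b₀ then P ab.1 else 1) =
    (∏ a, if a = a₀ then 1 else P a) * ∏ b, if b = b₀ then 1 else Q b := by
  rw [Fintype.prod_prod_type]
  have h1 : ∀ a, ∏ b, (if a = a₀ then (if b = b₀ then 1 else Q b) else
      if b = b₀ then P a else 1) =
      (if a = a₀ then 1 else P a) * (if a = a₀ then ∏ b, if b = b₀ then 1 else Q b else 1) := by
    intro a
    split_ifs with h
    · simp
    · simp
  rw [Finset.prod_congr rfl fun a _ => h1 a, Finset.prod_mul_distrib]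
  simp

/-- The two halves of the sides are independent, and the glued system is trivial off the two faces
through the origin. Products of dual functions thus become dual functions on the doubled cube, which
is why `WeightBounds` refers to `I ⊕ I`. -/
lemma dualFn_glue (g g' : (I → Bool) → G → ℝ) (x : G) :
    dualFn (glue g g') x = dualFn g x * dualFn g' x := by
  unfold dualFn
  rw [Fintype.expect_mul_expect]
  simp only [← Finset.expect_product']
  refine Fintype.expect_equiv (Equiv.sumArrowEquivProdArrow I I G) _ _ fun h => ?_
  change _ = (∏ ω, if ω = (fun _ => false) then 1 else g ω (x + vertex ω (h ∘ Sum.inl))) *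
    ∏ ω, if ω = (fun _ => false) then 1 else g' ω (x + vertex ω (h ∘ Sum.inr))
  rw [← prod_prod_cross (fun _ : I => false) (fun _ : I => false)
    (fun ω => g ω (x + vertex ω (h ∘ Sum.inl))) (fun ω => g' ω (x + vertex ω (h ∘ Sum.inr)))]
  refine Fintype.prod_equiv (Equiv.sumArrowEquivProdArrow I I Bool) _ _ fun ω => ?_
  have hv : vertex ω h = vertex (ω ∘ Sum.inl) (h ∘ Sum.inl) +
      vertex (ω ∘ Sum.inr) (h ∘ Sum.inr) := by
    simp [vertex, Fintype.sum_sum_type]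
  have h0 : ω = (fun _ => false) ↔ (ω ∘ Sum.inl = fun _ => false) ∧
      (ω ∘ Sum.inr = fun _ => false) := by
    constructor
    · rintro rfl; exact ⟨rfl, rfl⟩
    · rintro ⟨h1, h2⟩
      ext (i | i)
      · exact congrFun h1 i
      · exact congrFun h2 i
  change _ = (if ω ∘ Sum.inl = (fun _ => false) then
    (if ω ∘ Sum.inr = (fun _ => false) then 1 else g' (ω ∘ Sum.inr)
      (x + vertex (ω ∘ Sum.inr) (h ∘ Sum.inr)))
    else if ω ∘ Sum.inr = (fun _ => false) then g (ω ∘ Sum.inl)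
      (x + vertex (ω ∘ Sum.inl) (h ∘ Sum.inl)) else 1)
  by_cases h1 : ω ∘ Sum.inl = (fun _ => false) <;> by_cases h2 : ω ∘ Sum.inr = (fun _ => false)
  · rw [if_pos (h0.2 ⟨h1, h2⟩), if_pos h1, if_pos h2]
  · rw [if_neg (fun h => h2 (h0.1 h).2), if_pos h1, if_neg h2, hv, h1, vertex_false, zero_add,
      glue, if_pos h1]
  · rw [if_neg (fun h => h1 (h0.1 h).1), if_neg h1, if_pos h2, hv, h2, vertex_false, add_zero,
      glue, if_neg h1, if_pos h2]
  · rw [if_neg (fun h => h1 (h0.1 h).1), if_neg h1, if_neg h2, glue, if_neg h1, if_neg h2]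

/-! ### The class of dual functions -/

variable (I G) in
/-- The dual functions of systems of functions bounded by `1`. -/
def dualFns : Set (G → ℝ) :=
  {φ | ∃ g : (I → Bool) → G → ℝ, (∀ ω x, |g ω x| ≤ 1) ∧ φ = dualFn g}

lemma dualFn_one (x : G) : dualFn (fun (_ : I → Bool) (_ : G) => (1 : ℝ)) x = 1 := by
  simp [dualFn]

lemma isTestClass_dualFns : IsTestClass (dualFns I G) where
  one_mem := ⟨fun _ _ => 1, by simp, by ext x; rw [dualFn_one]⟩
  abs_le_one := by
    rintro _ ⟨g, hg, rfl⟩ x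
    exact (abs_dualFn_le hg x).trans (dualFn_one x).le
  mul := by
    rintro _ ⟨g, hg, rfl⟩ _ ⟨g', hg', rfl⟩ f c hf
    -- Giving the second cube the sides `H + h` merges both products, for each fixed `H`, into the
    -- dual function of a bounded system.
    set gH : (I → G) → (I → Bool) → G → ℝ := fun H ω x => g ω x * g' ω (x + vertex ω H) with hgH
    have h1 : ∀ x, dualFn g x * dualFn g' x = 𝔼 H : I → G, dualFn (gH H) x := by
      intro x
      unfold dualFn
      rw [Finset.expect_mul, Finset.expect_comm]
      refine Finset.expect_congr rfl fun h _ => ?_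
      rw [← expect_add_right _ h, Finset.mul_expect]
      refine Finset.expect_congr rfl fun H _ => ?_
      rw [← Finset.prod_mul_distrib]
      refine Finset.prod_congr rfl fun ω _ => ?_
      split_ifs
      · simp
      · rw [hgH, vertex_add, add_comm (vertex ω H), ← add_assoc]
    have h2 : 𝔼 x, f x * (dualFn g x * dualFn g' x) =
        𝔼 H : I → G, 𝔼 x, f x * dualFn (gH H) x := by
      simp only [h1, Finset.mul_expect]
      rw [Finset.expect_comm]
    rw [h2, one_mul]
    refine (Finset.abs_expect_le _ _).trans (Finset.expect_le Finset.univ_nonempty fun H _ => ?_)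
    refine hf _ ⟨gH H, fun ω x => ?_, rfl⟩
    rw [hgH, abs_mul]
    exact mul_le_one₀ (hg _ _) (abs_nonneg _) (hg' _ _)

/-! ### Replacing unbounded functions by bounded ones -/

variable (I) in
/-- The consequences of the linear forms condition for a single weight that are used below. -/
structure WeightBounds (ν : G → ℝ) (B θ : ℝ) : Prop where
  nonneg : ∀ x, 0 ≤ ν x
  mean_le : 𝔼 x, ν x ≤ 2
  dual_le : ∀ x, dualFn (fun (_ : I ⊕ I → Bool) y => ν y + 1) x ≤ B
  corr_le : ∀ g : (I ⊕ I → Bool) → G → ℝ, (∀ ω x, |g ω x| ≤ ν x + 1) →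
    |𝔼 x, (ν x - 1) * dualFn g x| ≤ θ

lemma WeightBounds.mono {ν : G → ℝ} {B θ θ' : ℝ} (h : WeightBounds I ν B θ) (hθ : θ ≤ θ') :
    WeightBounds I ν B θ' :=
  ⟨h.nonneg, h.mean_le, h.dual_le, fun g hg => (h.corr_le g hg).trans hθ⟩

lemma WeightBounds.abs_dualFn_le {ν : G → ℝ} {B θ : ℝ} (h : WeightBounds I ν B θ) {C : ℝ}
    (hC : 1 ≤ C) {g : (I → Bool) → G → ℝ} (hg : ∀ ω x, |g ω x| ≤ C * (ν x + 1)) (x : G) :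
    |dualFn g x| ≤ dualScale I C * B := by
  refine (PseudorandomDecomposition.abs_dualFn_le hg x).trans ?_
  rw [dualFn_const_mul C (fun (_ : I → Bool) x => ν x + 1)]
  refine mul_le_mul_of_nonneg_left ?_ (zero_le_one.trans (one_le_dualScale hC))
  have h1 : dualFn (fun (_ : I → Bool) x => ν x + 1) x =
      dualFn (glue (fun (_ : I → Bool) x => ν x + 1) (fun (_ : I → Bool) _ => 1)) x := by
    rw [dualFn_glue, dualFn_one, mul_one]
  rw [h1]
  refine (le_abs_self _).trans ((PseudorandomDecomposition.abs_dualFn_le (fun ω y => ?_) x).trans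
    (h.dual_le x))
  have h0 := h.nonneg y
  exact abs_glue_le (by linarith) (fun _ => by rw [abs_of_nonneg (by linarith)])
    (fun _ => by rw [abs_one]; linarith) ω

lemma WeightBounds.abs_corr_dualFns_le {ν : G → ℝ} {B θ : ℝ} (h : WeightBounds I ν B θ)
    {φ : G → ℝ} (hφ : φ ∈ dualFns I G) : |𝔼 x, (ν x - 1) * φ x| ≤ θ := by
  obtain ⟨g, hg, rfl⟩ := hφ
  have h1 := h.corr_le (glue g (fun (_ : I → Bool) _ => 1)) (fun ω x => by
    have h0 := h.nonneg x
    exact abs_glue_le (by linarith) (fun _ => (hg _ _).trans (by linarith))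
      (fun _ => by rw [abs_one]; linarith) ω)
  simpa only [dualFn_glue, dualFn_one, mul_one] using h1

lemma WeightBounds.abs_corr_sq_le {ν : G → ℝ} {B θ : ℝ} (h : WeightBounds I ν B θ) {C : ℝ}
    (hC : 1 ≤ C) {g : (I → Bool) → G → ℝ} (hg : ∀ ω x, |g ω x| ≤ C * (ν x + 1)) :
    |𝔼 x, (ν x - 1) * (dualFn g x * dualFn g x)| ≤ dualScale (I ⊕ I) C * θ := by
  have hC0 : 0 < C := zero_lt_one.trans_le hC
  have h1 := h.corr_le (fun ω x => C⁻¹ * glue g g ω x) (fun ω x => by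
    have h0 := h.nonneg x
    have h2 : |glue g g ω x| ≤ C * (ν x + 1) :=
      abs_glue_le (by nlinarith) (fun _ => hg _ _) (fun _ => hg _ _) ω
    rw [abs_mul, abs_of_pos (inv_pos.2 hC0), inv_mul_le_iff₀ hC0]
    exact h2)
  have h3 : ∀ x, dualFn g x * dualFn g x =
      dualScale (I ⊕ I) C * dualFn (fun ω x => C⁻¹ * glue g g ω x) x := by
    intro x
    rw [← dualFn_const_mul, ← dualFn_glue]
    congr 1
    ext ω y
    field_simp
  have h4 : 𝔼 x, (ν x - 1) * (dualFn g x * dualFn g x) = dualScale (I ⊕ I) C *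
      𝔼 x, (ν x - 1) * dualFn (fun ω x => C⁻¹ * glue g g ω x) x := by
    rw [Finset.mul_expect]
    exact Finset.expect_congr rfl fun x _ => by rw [h3]; ring
  have h5 : 0 ≤ dualScale (I ⊕ I) C := zero_le_one.trans (one_le_dualScale hC)
  rw [h4, abs_mul, abs_of_nonneg h5]
  exact mul_le_mul_of_nonneg_left h1 h5

/-- A cube average of functions dominated by `ν + 1` is small as soon as one of the functions
has small correlation with all dual functions of bounded systems. -/
lemma abs_cubeAvg_le_of_corr (B : ℝ) (S : Finset (I → Bool)) : (fun _ => false) ∉ S →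
    ∀ C : ℝ, 1 ≤ C → ∀ ε : ℝ, 0 < ε → ∃ θ : ℝ, 0 < θ ∧
    ∀ (G : Type) [AddCommGroup G] [Fintype G] (ν : G → ℝ), WeightBounds I ν B θ →
      ∀ g : (I → Bool) → G → ℝ, (∀ ω x, |g ω x| ≤ C * (ν x + 1)) →
        (∀ ω ∉ S, ω ≠ (fun _ => false) → ∀ x, |g ω x| ≤ C) →
        (∀ φ ∈ dualFns I G, |𝔼 x, g (fun _ => false) x * φ x| ≤ θ) → |cubeAvg g| ≤ ε := by
  induction S using Finset.induction_on with
  | empty =>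
    intro _ C hC ε hε
    have hs : 0 < dualScale I C := zero_lt_one.trans_le (one_le_dualScale hC)
    have hC0 : 0 < C := zero_lt_one.trans_le hC
    refine ⟨ε / dualScale I C, by positivity, fun G _ _ ν _ g _ hgC hcorr => ?_⟩
    set g' : (I → Bool) → G → ℝ := fun ω x => if ω = (fun _ => false) then 0 else C⁻¹ * g ω x
      with hg'
    have h1 := hcorr (dualFn g') ⟨g', fun ω x => by
      simp only [hg']
      split_ifs with h0
      · simp
      · rw [abs_mul, abs_of_pos (inv_pos.2 hC0), inv_mul_le_iff₀ hC0, mul_one]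
        exact hgC ω (by simp) h0 x, rfl⟩
    have h2 : ∀ x, dualFn g x = dualScale I C * dualFn g' x := by
      intro x
      rw [← dualFn_const_mul]
      refine dualFn_congr (fun ω hω => ?_) x
      ext y
      simp only [hg', if_neg hω]
      field_simp
    have h3 : cubeAvg g = dualScale I C * 𝔼 x, g (fun _ => false) x * dualFn g' x := by
      rw [cubeAvg_eq, Finset.mul_expect]
      exact Finset.expect_congr rfl fun x _ => by rw [h2]; ring
    rw [h3, abs_mul, abs_of_pos hs, mul_comm]
    exact (le_div_iff₀ hs).1 h1
  | insert ω₀ S hω₀S ih =>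
    intro h0S C hC ε hε
    have hω₀ : ω₀ ≠ (fun _ => false) := fun h => h0S (by rw [h]; exact Finset.mem_insert_self _ _)
    have h0S' : (fun _ => false) ∉ S := fun h => h0S (Finset.mem_insert_of_mem h)
    have hC0 : 0 < C := zero_lt_one.trans_le hC
    -- The bound for `D`, which takes the place of `g ω₀` in the induction.
    set C' := max C (dualScale I C * B) with hC'
    have hCC' : C ≤ C' := le_max_left _ _
    set δ := ε ^ 2 / (3 * C ^ 2) with hδ
    have hδ0 : 0 < δ := by positivity
    have hs : 0 < dualScale (I ⊕ I) C := zero_lt_one.trans_le (one_le_dualScale hC)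
    obtain ⟨θ₁, hθ₁, hIH⟩ := ih h0S' C' (hC.trans hCC') (δ / 4) (by positivity)
    refine ⟨min θ₁ (δ / 2 / dualScale (I ⊕ I) C), by positivity,
      fun G _ _ ν hν g hgW hgC hcorr => ?_⟩
    set θ := min θ₁ (δ / 2 / dualScale (I ⊕ I) C) with hθ
    set gr : (I → Bool) → G → ℝ := fun ω => g (reflect ω₀ ω) with hgr
    set D : G → ℝ := dualFn gr with hD
    have hgrW : ∀ ω x, |gr ω x| ≤ C * (ν x + 1) := fun ω x => hgW _ x
    have hDC : ∀ x, |D x| ≤ C' := fun x => (hν.abs_dualFn_le hC hgrW x).trans (le_max_right _ _)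
    have hgip : cubeAvg g = 𝔼 x, g ω₀ x * D x := by
      rw [← cubeAvg_reflect g ω₀, cubeAvg_eq, reflect_false]
    have hDD : cubeAvg (Function.update g ω₀ D) = 𝔼 x, D x * D x := by
      rw [← cubeAvg_reflect _ ω₀, cubeAvg_eq, reflect_false, Function.update_self]
      refine Finset.expect_congr rfl fun x _ => ?_
      congr 1
      refine dualFn_congr (fun ω hω => ?_) x
      rw [Function.update_of_ne]
      intro h
      apply hω
      rw [← reflect_false ω₀] at h
      exact (reflect ω₀).injective (by rwa [reflect_false] at h ⊢)
    have hDsq : 𝔼 x, D x * D x ≤ δ / 4 := by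
      rw [← hDD]
      refine (le_abs_self _).trans (hIH G ν (hν.mono (min_le_left _ _)) _ ?_ ?_ ?_)
      · intro ω x
        have h0 := hν.nonneg x
        have hC'0 : 0 ≤ C' := hC0.le.trans hCC'
        by_cases h : ω = ω₀
        · rw [h, Function.update_self]
          exact (hDC x).trans (le_mul_of_one_le_right hC'0 (by linarith))
        · rw [Function.update_of_ne h]
          exact (hgW ω x).trans (mul_le_mul_of_nonneg_right hCC' (by linarith))
      · intro ω hωS hω x
        by_cases h : ω = ω₀
        · rw [h, Function.update_self]
          exact hDC x
        · rw [Function.update_of_ne h]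
          refine (hgC ω (fun hmem => ?_) hω x).trans hCC'
          exact (Finset.mem_insert.1 hmem).elim h hωS
      · intro φ hφ
        rw [Function.update_of_ne hω₀.symm]
        exact (hcorr φ hφ).trans (min_le_left _ _)
    have hνD : 𝔼 x, (ν x - 1) * (D x * D x) ≤ δ / 2 := by
      refine (le_abs_self _).trans ((hν.abs_corr_sq_le hC hgrW).trans ?_)
      calc dualScale (I ⊕ I) C * θ ≤ dualScale (I ⊕ I) C * (δ / 2 / dualScale (I ⊕ I) C) :=
            mul_le_mul_of_nonneg_left (min_le_right _ _) hs.le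
        _ = δ / 2 := by field_simp
    -- Here `ν + 1 = (ν - 1) + 2`, so the bound is `δ / 2 + 2 * (δ / 4)`.
    have hWD : 𝔼 x, (ν x + 1) * (D x * D x) ≤ δ := by
      have h1 : 𝔼 x, (ν x + 1) * (D x * D x) =
          𝔼 x, (ν x - 1) * (D x * D x) + 2 * 𝔼 x, D x * D x := by
        rw [Finset.mul_expect, ← Finset.expect_add_distrib]
        exact Finset.expect_congr rfl fun x _ => by ring
      linarith
    have hW : 𝔼 x, (ν x + 1) ≤ 3 := by
      rw [Finset.expect_add_distrib, Fintype.expect_one]; linarith [hν.mean_le]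
    have hW0 : ∀ x, 0 ≤ ν x + 1 := fun x => by linarith [hν.nonneg x]
    have hCS : (𝔼 x, (ν x + 1) * |D x|) ^ 2 ≤ 3 * δ := by
      have h1 := Finset.expect_mul_sq_le_sq_mul_sq Finset.univ (fun x => √(ν x + 1))
        (fun x => √(ν x + 1) * |D x|)
      have h2 : ∀ x, √(ν x + 1) * (√(ν x + 1) * |D x|) = (ν x + 1) * |D x| := fun x => by
        rw [← mul_assoc, Real.mul_self_sqrt (hW0 x)]
      have h3 : ∀ x, (√(ν x + 1) * |D x|) ^ 2 = (ν x + 1) * (D x * D x) := fun x => by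
        rw [mul_pow, Real.sq_sqrt (hW0 x), sq_abs, pow_two]
      simp only [h2, h3, Real.sq_sqrt (hW0 _)] at h1
      refine h1.trans (mul_le_mul hW hWD ?_ (by norm_num))
      exact Finset.expect_nonneg fun x _ => mul_nonneg (hW0 x) (mul_self_nonneg _)
    have hfin : |cubeAvg g| ≤ C * 𝔼 x, (ν x + 1) * |D x| := by
      rw [hgip, Finset.mul_expect]
      refine (Finset.abs_expect_le _ _).trans (Finset.expect_le_expect fun x _ => ?_)
      rw [abs_mul, ← mul_assoc]
      exact mul_le_mul_of_nonneg_right (hgW ω₀ x) (abs_nonneg _)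
    refine hfin.trans ?_
    refine le_of_sq_le_sq ?_ hε.le
    rw [mul_pow]
    calc C ^ 2 * (𝔼 x, (ν x + 1) * |D x|) ^ 2 ≤ C ^ 2 * (3 * δ) :=
          mul_le_mul_of_nonneg_left hCS (by positivity)
      _ = ε ^ 2 := by rw [hδ]; field_simp

end Cube

/-! ### Consequences of the linear forms condition -/

section LinearForms

variable {J : Type} [Fintype J] [DecidableEq J]

/-- The coefficients of the form `a x + ω · h` in the variables `(x, h)`. -/
def cubeCoeff (a : ℤ) (ω : J → Bool) (o : Option J) : ℤ :=
  o.elim a fun j => if ω j then 1 else 0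

set_option linter.unusedSectionVars false in
lemma cubeCoeff_ne_zero {a : ℤ} {ω : J → Bool} (h : a = 1 ∨ ω ≠ fun _ => false) :
    ∃ o, cubeCoeff a ω o = 1 := by
  rcases h with h | h
  · exact ⟨none, h⟩
  · obtain ⟨j, hj⟩ := Function.ne_iff.1 h
    exact ⟨some j, by simp [cubeCoeff, Bool.eq_true_of_not_eq_false hj]⟩

/-- A coordinate `j` with `ω j ≠ ω' j` kills one scalar; a coordinate where the other form has
coefficient `1` kills the other. -/
lemma linearIndependent_cubeCoeff {α : Type*} (σ : α ≃ Option J) {a : ℤ} {ω ω' : J → Bool}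
    (h : a = 1 ∨ ω ≠ fun _ => false) (h' : a = 1 ∨ ω' ≠ fun _ => false) (hne : ω ≠ ω') :
    LinearIndependent ℤ ![fun j => cubeCoeff a ω (σ j), fun j => cubeCoeff a ω' (σ j)] := by
  rw [LinearIndependent.pair_iff]
  intro s t hst
  have hval : ∀ o, s * cubeCoeff a ω o + t * cubeCoeff a ω' o = 0 := fun o => by
    simpa using congrFun hst (σ.symm o)
  obtain ⟨o, ho⟩ := cubeCoeff_ne_zero h
  obtain ⟨o', ho'⟩ := cubeCoeff_ne_zero h'
  have h1 := hval o
  have h2 := hval o'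
  rw [ho] at h1
  rw [ho'] at h2
  obtain ⟨j, hj⟩ := Function.ne_iff.1 hne
  have h3 := hval (some j)
  cases hω : ω j <;> cases hω' : ω' j <;> simp [cubeCoeff, hω, hω'] at h3 hj
  · subst h3; simp at h1; exact ⟨h1, rfl⟩
  · subst h3; simp at h2; exact ⟨rfl, h2⟩

/-- For `a = 1` the base point is averaged; for `a = 0` it is frozen at `x₀`, a constant term, and
uniformity in the constants gives a pointwise estimate. The vertex `0` is then excluded because its
form would be constant. -/
lemma LinearFormsCondition.cube {ν : (N : ℕ) → ZMod N → ℝ}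
    (hν : LinearFormsCondition (Fintype.card (J → Bool)) (Fintype.card (Option J)) 1 ν)
    {η : ℝ} (hη : 0 < η) : ∃ N₀ : ℕ, ∀ (N : ℕ) [Fact N.Prime], N₀ < N →
      ∀ (S : Finset (J → Bool)) (a : ℤ) (x₀ : ZMod N), (a = 0 ∨ a = 1) →
        (∀ ω ∈ S, a = 1 ∨ ω ≠ fun _ => false) →
        |𝔼 x : ZMod N, 𝔼 h : J → ZMod N, ∏ ω ∈ S, ν N (x₀ + a * x + vertex ω h) - 1| ≤ η := by
  obtain ⟨N₀, hN₀⟩ := hν η hη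
  refine ⟨N₀, fun N _ hN S a x₀ ha hS => ?_⟩
  set σ := (Fintype.equivFin (Option J)).symm with hσ
  set e := S.equivFin.symm with he
  have h := hN₀ N hN S.card (Finset.card_le_univ S) (fun _ => (x₀.val : ℤ))
    (fun i j => cubeCoeff a (e i : J → Bool) (σ j)) ?_ ?_ ?_
  · have h1 : 𝔼 y : Fin (Fintype.card (Option J)) → ZMod N, ∏ i, ν N (((x₀.val : ℤ) : ZMod N) +
        ∑ j, (cubeCoeff a (e i : J → Bool) (σ j) : ZMod N) * y j) =
        𝔼 x : ZMod N, 𝔼 h : J → ZMod N, ∏ ω ∈ S, ν N (x₀ + a * x + vertex ω h) := by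
      rw [← Finset.expect_product', Finset.univ_product_univ]
      refine Fintype.expect_equiv ((Equiv.arrowCongr σ (Equiv.refl _)).trans
        (Equiv.piOptionEquivProd (β := fun _ : Option J => ZMod N))) _ _ fun y => ?_
      rw [← Finset.prod_coe_sort S]
      refine Fintype.prod_equiv e _ _ fun i => ?_
      congr 1
      rw [Int.cast_natCast, ZMod.natCast_zmod_val, add_assoc]
      congr 1
      rw [← Equiv.sum_comp σ.symm, Fintype.sum_option]
      simp [cubeCoeff, vertex, Equiv.piOptionEquivProd]
    rwa [h1] at h
  · intro i j
    rcases σ j with _ | j'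
    · rcases ha with rfl | rfl <;> simp [cubeCoeff]
    · simp only [cubeCoeff, Option.elim]
      split_ifs <;> simp
  · intro i h0
    obtain ⟨o, ho⟩ := cubeCoeff_ne_zero (hS _ (e i).2)
    have := congrFun h0 (σ.symm o)
    simp [ho] at this
  · intro i i' hii'
    refine linearIndependent_cubeCoeff σ (hS _ (e i).2) (hS _ (e i').2) fun h => hii' ?_
    exact e.injective (Subtype.ext h)

end LinearForms

/-- Expand over subsets of vertices. The signs sum to zero, so `1` may be subtracted from each
average. -/
lemma abs_cubeAvg_sub_one_le {J G : Type} [Fintype J] [DecidableEq J] [AddCommGroup G] [Fintype G]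
    (ν : G → ℝ) (η : ℝ)
    (h : ∀ S : Finset (J → Bool), |𝔼 x : G, 𝔼 h : J → G, ∏ ω ∈ S, ν (x + vertex ω h) - 1| ≤ η) :
    |cubeAvg (fun (_ : J → Bool) x => ν x - 1)| ≤ 2 ^ Fintype.card (J → Bool) * η := by
  classical
  have h0 : ∑ S : Finset (J → Bool), ∏ _ω ∈ Finset.univ \ S, (-1 : ℝ) = 0 := by
    have := Finset.prod_add (fun _ : J → Bool => (1 : ℝ)) (fun _ => -1) Finset.univ
    simpa using this.symm
  have h1 : cubeAvg (fun (_ : J → Bool) x => ν x - 1) =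
      ∑ S : Finset (J → Bool), (∏ _ω ∈ Finset.univ \ S, (-1 : ℝ)) *
        (𝔼 x : G, 𝔼 h : J → G, ∏ ω ∈ S, ν (x + vertex ω h) - 1) := by
    simp only [mul_sub, Finset.sum_sub_distrib, mul_one, h0, sub_zero]
    simp only [cubeAvg, sub_eq_add_neg, Finset.prod_add, Finset.powerset_univ,
      Finset.expect_sum_comm, Finset.mul_expect]
    simp only [mul_comm]
  rw [h1]
  refine (Finset.abs_sum_le_sum_abs _ _).trans ?_
  calc _ ≤ ∑ _S : Finset (J → Bool), η := Finset.sum_le_sum fun S _ => by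
        rw [abs_mul, Finset.abs_prod]
        simpa using h S
    _ = _ := by simp

lemma expect_prod_add_one_le {A X : Type} [Fintype X] (s : Finset A) (F : A → X → ℝ) (b : ℝ)
    (h : ∀ S ⊆ s, 𝔼 x, ∏ ω ∈ S, F ω x ≤ b) : 𝔼 x, ∏ ω ∈ s, (F ω x + 1) ≤ 2 ^ s.card * b := by
  classical
  simp only [Finset.prod_add_one, Finset.expect_sum_comm]
  calc _ ≤ ∑ _S ∈ s.powerset, b := Finset.sum_le_sum fun S hS => h S (Finset.mem_powerset.1 hS)
    _ = _ := by simp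

lemma LinearFormsCondition.weightBounds {I : Type} [Fintype I] [DecidableEq I]
    {ν : (N : ℕ) → ZMod N → ℝ} (hν0 : ∀ (N : ℕ) [Fact N.Prime] (x : ZMod N), 0 ≤ ν N x)
    (hν : LinearFormsCondition (Fintype.card (I ⊕ I → Bool)) (Fintype.card (Option (I ⊕ I))) 1 ν)
    {θ : ℝ} (hθ : 0 < θ) : ∃ N₀ : ℕ, ∀ (N : ℕ) [Fact N.Prime], N₀ < N →
      WeightBounds I (ν N) (2 ^ Fintype.card (I ⊕ I → Bool) * 2) θ := by
  classical
  set K := Fintype.card (I ⊕ I → Bool) with hK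
  obtain ⟨θ₀, hθ₀, hsmall⟩ := abs_cubeAvg_small (I := I ⊕ I) (2 ^ K * 2)
    (by have : (1 : ℝ) ≤ 2 ^ K := one_le_pow₀ one_le_two
        linarith) Finset.univ θ hθ
  obtain ⟨N₀, hN₀⟩ := hν.cube (η := min 1 (θ₀ / 2 ^ K)) (by positivity)
  refine ⟨N₀, fun N _ hN => ?_⟩
  have hfull : ∀ S : Finset (I ⊕ I → Bool),
      |𝔼 x : ZMod N, 𝔼 h : I ⊕ I → ZMod N, ∏ ω ∈ S, ν N (x + vertex ω h) - 1| ≤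
        min 1 (θ₀ / 2 ^ K) := fun S => by
    simpa using hN₀ N hN S 1 0 (Or.inr rfl) fun _ _ => Or.inl rfl
  have hpoint : ∀ (S : Finset (I ⊕ I → Bool)), (fun _ => false) ∉ S → ∀ x : ZMod N,
      |𝔼 h : I ⊕ I → ZMod N, ∏ ω ∈ S, ν N (x + vertex ω h) - 1| ≤ min 1 (θ₀ / 2 ^ K) :=
    fun S hS x => by
      simpa using hN₀ N hN S 0 x (Or.inl rfl) fun ω hω => Or.inr fun h => hS (h ▸ hω)
  have hW : ∀ x : ZMod N, |ν N x - 1| ≤ ν N x + 1 := fun x => by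
    rw [abs_le]; constructor <;> linarith [hν0 N x]
  have hWavg : cubeAvg (fun (_ : I ⊕ I → Bool) x => ν N x + 1) ≤ 2 ^ K * 2 := by
    unfold cubeAvg
    rw [← Finset.expect_product' (f := fun x h => ∏ ω, (ν N (x + vertex ω h) + 1)),
      Finset.univ_product_univ]
    refine (expect_prod_add_one_le Finset.univ
      (fun ω (p : ZMod N × (I ⊕ I → ZMod N)) => ν N (p.1 + vertex ω p.2)) 2 fun S _ => ?_).trans
      (by rw [Finset.card_univ])
    rw [← Finset.univ_product_univ,
      Finset.expect_product' (f := fun x h => ∏ ω ∈ S, ν N (x + vertex ω h))]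
    linarith [(abs_le.1 (hfull S)).2, min_le_left 1 (θ₀ / 2 ^ K)]
  refine ⟨hν0 N, ?_, fun x => ?_, fun g hg => ?_⟩
  · have h1 := hfull {fun _ => false}
    simp only [Finset.prod_singleton, vertex_false, add_zero, Fintype.expect_const] at h1
    linarith [(abs_le.1 h1).2, min_le_left 1 (θ₀ / 2 ^ K)]
  · have h1 : dualFn (fun (_ : I ⊕ I → Bool) y => ν N y + 1) x = 𝔼 h : I ⊕ I → ZMod N,
        ∏ ω ∈ Finset.univ.erase (fun _ => false), (ν N (x + vertex ω h) + 1) := by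
      unfold dualFn
      refine Finset.expect_congr rfl fun h _ => ?_
      rw [← Finset.mul_prod_erase _ _ (Finset.mem_univ fun _ => false), if_pos rfl, one_mul]
      exact Finset.prod_congr rfl fun ω hω => if_neg (Finset.ne_of_mem_erase hω)
    rw [h1]
    refine (expect_prod_add_one_le _ (fun ω (h : I ⊕ I → ZMod N) => ν N (x + vertex ω h)) 2
      fun S hS => ?_).trans ?_
    · have := hpoint S (fun h => Finset.notMem_erase _ _ (hS h)) x
      linarith [(abs_le.1 this).2, min_le_left 1 (θ₀ / 2 ^ K)]
    · gcongr
      · exact one_le_two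
      · exact Finset.card_le_univ _
  · have h1 : 𝔼 x, (ν N x - 1) * dualFn g x =
        cubeAvg (Function.update g (fun _ => false) fun x => ν N x - 1) := by
      rw [cubeAvg_eq, Function.update_self]
      refine Finset.expect_congr rfl fun x _ => ?_
      rw [dualFn_congr (g := Function.update g _ _) (g' := g) fun ω hω =>
        Function.update_of_ne hω _ _]
    rw [h1]
    refine hsmall (ZMod N) (fun x => ν N x - 1) (fun x => ν N x + 1) hW hWavg ?_ _ ?_ ?_
    · refine (abs_cubeAvg_sub_one_le (ν N) _ hfull).trans ?_
      calc (2 : ℝ) ^ K * min 1 (θ₀ / 2 ^ K) ≤ 2 ^ K * (θ₀ / 2 ^ K) :=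
            mul_le_mul_of_nonneg_left (min_le_right _ _) (by positivity)
        _ = θ₀ := by field_simp
    · intro ω x
      by_cases h : ω = fun _ => false
      · rw [h, Function.update_self]; exact hW x
      · rw [Function.update_of_ne h]; exact hg ω x
    · intro ω hω
      have : ω = fun _ => false := funext fun i => hω i (Finset.mem_univ i)
      rw [this, Function.update_self]

/-! ### Assembling the decomposition -/

lemma condExpect_comap {N : ℕ} [NeZero N] {ι : Type} (c : ZMod N → ι) (f : ZMod N → ℝ) :
    condExpect (MeasurableSpace.comap c ⊤) f = fiberAvg c f := by
  classical
  ext x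
  unfold condExpect fiberAvg
  refine Finset.expect_congr ?_ fun _ _ => rfl
  ext y
  simp only [Finset.mem_filter, Finset.mem_univ, true_and]
  constructor
  · intro h
    have : @MeasurableSet _ (MeasurableSpace.comap c ⊤) (c ⁻¹' {c x}) := ⟨{c x}, trivial, rfl⟩
    exact @mem_of_mem_measurableAtom _ (MeasurableSpace.comap c ⊤) x y h _ this rfl
  · intro h
    simp only [measurableAtom, Set.mem_iInter]
    rintro s hxs ⟨t, -, rfl⟩
    simpa [h] using hxs

/-- Take for `δ N` the infimum of the admissible errors, plus `1 / (N + 1)` since it need not be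
attained. Beyond the threshold for `η = 1` there is an admissible error. -/
lemma exists_tendsto_zero_of_eventually (P : ℝ → ℕ → Prop)
    (hmono : ∀ a b N, a ≤ b → P a N → P b N)
    (h : ∀ η : ℝ, 0 < η → ∃ N₀ : ℕ, ∀ N, N₀ < N → P η N) :
    ∃ (N₀ : ℕ) (δ : ℕ → ℝ), Filter.Tendsto δ Filter.atTop (nhds 0) ∧ ∀ N, N₀ < N → P (δ N) N := by
  obtain ⟨N₀, hN₀⟩ := h 1 one_pos
  set E : ℕ → Set ℝ := fun N => {η | 0 < η ∧ P η N} with hE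
  have hbdd : ∀ N, BddBelow (E N) := fun N => ⟨0, fun η hη => hη.1.le⟩
  have hinf0 : ∀ N, 0 ≤ sInf (E N) := fun N => Real.sInf_nonneg fun η hη => hη.1.le
  refine ⟨N₀, fun N => sInf (E N) + 1 / ((N : ℝ) + 1), ?_, fun N hN => ?_⟩
  · rw [← add_zero (0 : ℝ)]
    refine Filter.Tendsto.add ?_ tendsto_one_div_add_atTop_nhds_zero_nat
    rw [Metric.tendsto_atTop]
    intro η hη
    obtain ⟨N₁, hN₁⟩ := h (η / 2) (by positivity)
    refine ⟨N₁ + 1, fun N hN => ?_⟩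
    rw [Real.dist_eq, sub_zero, abs_of_nonneg (hinf0 N)]
    have : sInf (E N) ≤ η / 2 := csInf_le (hbdd N) ⟨by positivity, hN₁ N (by omega)⟩
    linarith
  · obtain ⟨η, hη, hlt⟩ := Real.lt_sInf_add_pos (s := E N) ⟨1, one_pos, hN₀ N hN⟩
      (by positivity : 0 < 1 / ((N : ℝ) + 1))
    exact hmono η _ N hlt.le hη.2

/-- The decomposition with a prescribed bound `η` on the errors. -/
lemma eventually_exists_sigmaAlgebra (k : ℕ) {ν : (N : ℕ) → ZMod N → ℝ}
    (hν0 : ∀ (N : ℕ) [Fact N.Prime] (x : ZMod N), 0 ≤ ν N x)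
    (hν : LinearFormsCondition (Fintype.card (Fin k ⊕ Fin k → Bool))
      (Fintype.card (Option (Fin k ⊕ Fin k))) 1 ν)
    {ε η : ℝ} (hε : 0 < ε) (hη : 0 < η) (hη1 : η ≤ 1) :
    ∃ N₀ : ℕ, ∀ (N : ℕ) [Fact N.Prime], N₀ < N →
      ∀ f : ZMod N → ℝ, (∀ x, 0 ≤ f x ∧ f x ≤ ν N x) →
        ∃ (B : MeasurableSpace (ZMod N)) (Ω : Set (ZMod N)), @MeasurableSet (ZMod N) B Ω ∧
          |𝔼 x : ZMod N, ν N x * Ω.indicator 1 x| ≤ η ∧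
          ‖fun x : ZMod N => (1 - Ω.indicator (1 : ZMod N → ℝ) x) *
            condExpect B (fun y => ν N y - 1) x‖ ≤ η ∧
          gowersNorm k (fun x : ZMod N => (1 - Ω.indicator (1 : ZMod N → ℝ) x) *
            (f x - condExpect B f x)) ≤ ε := by
  classical
  -- All nonzero vertices count as unbounded, since each carries the same `F`, with `|F| ≤ 2 * (ν +
  -- 1)`.
  obtain ⟨θ₁, hθ₁, hcount⟩ := abs_cubeAvg_le_of_corr (I := Fin k)
    (2 ^ Fintype.card (Fin k ⊕ Fin k → Bool) * 2) (Finset.univ.erase fun _ => false) (by simp)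
    2 one_le_two (ε ^ (2 ^ k)) (by positivity)
  -- With `κ = η ^ 2 / 2` the exceptional set has `ν`-mass at most `κ + κ / η ≤ η`.
  obtain ⟨θ₂, hθ₂, hpart⟩ := exists_partition θ₁ η (η ^ 2 / 2) hθ₁ hη hη1 (by positivity)
  obtain ⟨N₀, hN₀⟩ := hν.weightBounds (I := Fin k) hν0 (lt_min hθ₁ hθ₂)
  refine ⟨N₀, fun N _ hN f hf => ?_⟩
  have hw := hN₀ N hN
  obtain ⟨ι, c, hL1, hcorr⟩ := hpart (ZMod N) (dualFns (Fin k) (ZMod N)) isTestClass_dualFns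
    (ν N) f (fun x => (hf x).1) (fun x => (hf x).2)
    (fun φ hφ => (hw.mono (min_le_right _ _)).abs_corr_dualFns_le hφ)
  set Ω := exceptionalSet c (ν N) η with hΩ
  refine ⟨MeasurableSpace.comap c ⊤, Ω, ?_, ?_, ?_, ?_⟩
  · refine ⟨c '' Ω, trivial, ?_⟩
    ext x
    constructor
    · rintro ⟨y, hy, hxy⟩
      have h1 : η < |fiberAvg c (fun y => ν N y - 1) y| := hy
      rwa [fiberAvg_congr c _ hxy] at h1
    · exact fun hx => ⟨x, hx, rfl⟩
  · have hnn : 0 ≤ 𝔼 x, ν N x * Ω.indicator (1 : ZMod N → ℝ) x :=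
      Finset.expect_nonneg fun x _ =>
        mul_nonneg (hν0 N x) (Set.indicator_nonneg (fun _ _ => zero_le_one) x)
    rw [abs_of_nonneg hnn]
    refine (expect_mul_exceptionalSet_le c (ν N) hη hL1).trans ?_
    have : η ^ 2 / 2 / η = η / 2 := by field_simp
    rw [this]
    nlinarith
  · rw [pi_norm_le_iff_of_nonneg hη.le, condExpect_comap]
    intro x
    by_cases hx : x ∈ Ω
    · simpa [hx] using hη.le
    · have h1 : |fiberAvg c (fun y => ν N y - 1) x| ≤ η := not_lt.1 hx
      simpa [hx] using h1
  · rw [condExpect_comap]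
    set F : ZMod N → ℝ := fun x => (1 - Ω.indicator (1 : ZMod N → ℝ) x) * (f x - fiberAvg c f x)
      with hF
    have hFle : ∀ x, |F x| ≤ 2 * (ν N x + 1) := by
      intro x
      have h0 := hν0 N x
      by_cases hx : x ∈ Ω
      · simp only [hF, Set.indicator_of_mem hx, Pi.one_apply, sub_self, zero_mul, abs_zero]
        linarith
      · simp only [hF, Set.indicator_of_notMem hx, sub_zero, one_mul]
        have h1 := fiberAvg_le_two c (fun x => (hf x).2) hη1 hx
        have h2 := fiberAvg_nonneg c (fun x => (hf x).1) x
        rw [abs_le]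
        constructor <;> linarith [hf x]
    have hG : |cubeAvg (fun _ : Fin k → Bool => F)| ≤ ε ^ (2 ^ k) :=
      hcount (ZMod N) (ν N) (hw.mono (min_le_left _ _)) (fun _ => F) (fun _ => hFle)
        (fun ω hω hω0 => absurd (Finset.mem_erase.2 ⟨hω0, Finset.mem_univ _⟩) hω) hcorr
    have hgn : gowersNorm k F = cubeAvg (fun _ : Fin k → Bool => F) ^ ((1 : ℝ) / 2 ^ k) := rfl
    rw [hgn]
    -- Passing to absolute values makes the sign of the cube average irrelevant.
    refine (le_abs_self _).trans ((Real.abs_rpow_le_abs_rpow _ _).trans ?_)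
    refine (Real.rpow_le_rpow (abs_nonneg _) hG (by positivity)).trans ?_
    rw [← Real.rpow_natCast, ← Real.rpow_mul hε.le]
    push_cast
    rw [mul_one_div_cancel (by positivity), Real.rpow_one]

end PseudorandomDecomposition

end

theorem proposition3p4 (k : ℕ) (hk : 2 ≤ k) :
    ∃ m₀ t L q₀ : ℕ, ∀ ν : (N : ℕ) → ZMod N → ℝ,
      PseudorandomDecomposition.IsPseudorandom m₀ t L q₀ ν →
      ∀ ε : ℝ, 0 < ε →
        ∃ (N₀ : ℕ) (δ : ℕ → ℝ), Filter.Tendsto δ Filter.atTop (nhds 0) ∧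
          ∀ (N : ℕ) [Fact N.Prime], N₀ < N →
            ∀ f : ZMod N → ℝ, (∀ x, 0 ≤ f x ∧ f x ≤ ν N x) →
              ∃ (B : MeasurableSpace (ZMod N)) (Ω : Set (ZMod N)),
                @MeasurableSet (ZMod N) B Ω ∧
                |𝔼 x : ZMod N, ν N x * Ω.indicator 1 x| ≤ δ N ∧
                ‖fun x : ZMod N => (1 - Ω.indicator (1 : ZMod N → ℝ) x) *
                    PseudorandomDecomposition.condExpect B (fun y => ν N y - 1) x‖ ≤ δ N ∧
                PseudorandomDecomposition.gowersNorm k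
                    (fun x : ZMod N => (1 - Ω.indicator (1 : ZMod N → ℝ) x) *
                      (f x - PseudorandomDecomposition.condExpect B f x)) ≤ ε := by
  -- The linear forms condition suffices: no correlation is needed.
  refine ⟨Fintype.card (Fin k ⊕ Fin k → Bool), Fintype.card (Option (Fin k ⊕ Fin k)), 1, 0,
    fun ν hν ε hε => ?_⟩
  obtain ⟨N₀, δ, hδ, h⟩ := PseudorandomDecomposition.exists_tendsto_zero_of_eventually
    (fun η N => ∀ [Fact N.Prime], ∀ f : ZMod N → ℝ, (∀ x, 0 ≤ f x ∧ f x ≤ ν N x) →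
      ∃ (B : MeasurableSpace (ZMod N)) (Ω : Set (ZMod N)), @MeasurableSet (ZMod N) B Ω ∧
        |𝔼 x : ZMod N, ν N x * Ω.indicator 1 x| ≤ η ∧
        ‖fun x : ZMod N => (1 - Ω.indicator (1 : ZMod N → ℝ) x) *
          PseudorandomDecomposition.condExpect B (fun y => ν N y - 1) x‖ ≤ η ∧
        PseudorandomDecomposition.gowersNorm k
          (fun x : ZMod N => (1 - Ω.indicator (1 : ZMod N → ℝ) x) *
            (f x - PseudorandomDecomposition.condExpect B f x)) ≤ ε)
    (fun a b N hab hP _ f hf => by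
      obtain ⟨B, Ω, h1, h2, h3, h4⟩ := hP f hf
      exact ⟨B, Ω, h1, h2.trans hab, h3.trans hab, h4⟩)
    (fun η hη => by
      obtain ⟨N₀, hN₀⟩ := PseudorandomDecomposition.eventually_exists_sigmaAlgebra k hν.nonneg
        hν.linearForms hε (lt_min hη one_pos) (min_le_right η 1)
      refine ⟨N₀, fun N hN _ f hf => ?_⟩
      obtain ⟨B, Ω, h1, h2, h3, h4⟩ := hN₀ N hN f hf
      exact ⟨B, Ω, h1, h2.trans (min_le_left _ _), h3.trans (min_le_left _ _), h4⟩)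
  exact ⟨N₀, δ, hδ, fun N _ hN f hf => h N hN f hf⟩
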